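/- Let $\Gamma\subset\mathbb{C}$ be a positively oriented rectifiable closed Jordan curve with interior $\Omega_+$ and exterior $\Omega_-$ (the bounded and the unbounded component of $\mathbb{C}\setminus\Gamma$), positive orientation meaning that $\Gamma$ has winding number $1$ about every point of $\Omega_+$. Let $k\ge 0$ be an integer and let $\partial_{\bar z}=\tfrac12(\partial_x+i\,\partial_y)$. Let $F\in C^{k+1}(\Omega_-)\cap C^{k}(\Omega_-\cup\Gamma)$ be $(k+1)$-analytic in $\Omega_-$, that is, $\partial_{\bar z}^{k+1}F=0$ in $\Omega_-$; here $F\in C^k(\Omega_-\cup\Gamma)$ means that all partial derivatives of $F$ of order at most $k$ extend continuously from $\Omega_-$ to $\Omega_-\cup\Gamma$, and the values of $\partial_{\bar\zeta}^mF$ on $\Gamma$ are those of the continuous extensions. Then $F$ can be written as $F(z)=\sum_{m=0}^{k}F_m(z)\,\bar z^{m}$ for $z\in\Omega_-$, with $F_0,\dots,F_k$ analytic in $\Omega_-$ (the analytic components of $F$). If the analytic components $F_0,\dots,F_k$ are bounded in a neighbourhood of $\infty$, then the limits $F_m(\infty)=\lim_{z\to\infty}F_m(z)$ exist, and for every $z\in\Omega_-$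 $$F(z)=-\sum_{m=0}^{k}\frac{1}{2\pi i}\int_{\Gamma}\frac{(\overline{z-\zeta})^{m}}{m!\,(\zeta-z)}\,\partial_{\bar\zeta}^{m}F(\zeta)\,d\zeta+\sum_{m=0}^{k}F_m(\infty)\,\bar z^{m}.$$ -/

import Mathlib

open Set Filter Topology

noncomputable section

/-- `γ : [a, b] → ℂ` is an absolutely continuous parametrization of a closed Jordan curve.
Every rectifiable closed Jordan curve has one (for instance by arc length), and so does every
piecewise `C¹` closed Jordan curve. -/
structure IsRectifiableJordanCurve (γ : ℝ → ℂ) (a b : ℝ) : Prop where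
  lt : a < b
  absolutelyContinuous : AbsolutelyContinuousOnInterval γ a b
  closed : γ a = γ b
  injOn : InjOn γ (Ico a b)

/-- The trace `Γ = γ([a, b])` of the curve. -/
def curveTrace (γ : ℝ → ℂ) (a b : ℝ) : Set ℂ := γ '' Icc a b

/-- The contour integral `∫_Γ f(ζ) dζ`. -/
def contourIntegral (γ : ℝ → ℂ) (a b : ℝ) (f : ℂ → ℂ) : ℂ :=
  ∫ t in a..b, f (γ t) * deriv γ t

/-- `Ω₊`: the points off `Γ` whose component in the complement of `Γ` is bounded. -/
def curveInterior (γ : ℝ → ℂ) (a b : ℝ) : Set ℂ :=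
  {z | z ∉ curveTrace γ a b ∧
    Bornology.IsBounded (connectedComponentIn (curveTrace γ a b)ᶜ z)}

/-- `Ω₋`: the points off `Γ` whose component in the complement of `Γ` is unbounded. -/
def curveExterior (γ : ℝ → ℂ) (a b : ℝ) : Set ℂ :=
  {z | z ∉ curveTrace γ a b ∧
    ¬ Bornology.IsBounded (connectedComponentIn (curveTrace γ a b)ᶜ z)}

/-- Positive orientation: the winding number about each point of the interior is `1`. -/
def IsPositivelyOriented (γ : ℝ → ℂ) (a b : ℝ) : Prop :=
  ∀ z ∈ curveInterior γ a b,
    1 / (2 * Real.pi * Complex.I) * contourIntegral γ a b (fun ζ => 1 / (ζ - z)) = 1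

/-- The complex partial derivative `∂_z = (∂_x - i ∂_y) / 2`. -/
def dz (F : ℂ → ℂ) (z : ℂ) : ℂ :=
  (fderiv ℝ F z 1 - Complex.I * fderiv ℝ F z Complex.I) / 2

/-- The complex partial derivative `∂_{z̄} = (∂_x + i ∂_y) / 2`. -/
def dbar (F : ℂ → ℂ) (z : ℂ) : ℂ :=
  (fderiv ℝ F z 1 + Complex.I * fderiv ℝ F z Complex.I) / 2

/-- `g` is a continuous extension to `U ∪ Γ` of the function `f` on `U`. -/
def IsContinuousExtension (U Γ : Set ℂ) (f g : ℂ → ℂ) : Prop :=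
  ContinuousOn g (U ∪ Γ) ∧ EqOn g f U

/-- `F ∈ C^k(U ∪ Γ)` for an open set `U`: `F` is `C^k` on `U`, and all its partial derivatives
of order at most `k` extend continuously to `U ∪ Γ`. -/
def IsContDiffUpTo (k : ℕ) (F : ℂ → ℂ) (U Γ : Set ℂ) : Prop :=
  ContDiffOn ℝ k F U ∧
    ∀ i j : ℕ, i + j ≤ k → ∃ g : ℂ → ℂ, IsContinuousExtension U Γ (dz^[i] (dbar^[j] F)) g

/-- `F` is `n`-analytic in the open set `U`: it is a `C^n` solution of `∂_{z̄}^n F = 0`. -/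
def IsPolyanalyticOn (n : ℕ) (F : ℂ → ℂ) (U : Set ℂ) : Prop :=
  ContDiffOn ℝ n F U ∧ ∀ z ∈ U, (dbar^[n] F) z = 0

/-- `Fc 0, …, Fc k` are the analytic components of the `(k+1)`-analytic function `F` in `U`:
they are analytic in `U`, and `F(z) = ∑_{m ≤ k} Fc m (z) z̄^m` there. -/
def IsAnalyticComponents (k : ℕ) (F : ℂ → ℂ) (U : Set ℂ) (Fc : ℕ → ℂ → ℂ) : Prop :=
  (∀ m ≤ k, DifferentiableOn ℂ (Fc m) U) ∧
    ∀ z ∈ U, F z = ∑ m ∈ Finset.range (k + 1), Fc m z * (starRingEnd ℂ z) ^ m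

/-- `f` is bounded near `∞`. -/
def IsBoundedAtInfty (f : ℂ → ℂ) : Prop :=
  ∃ C R : ℝ, ∀ z : ℂ, R ≤ ‖z‖ → ‖f z‖ ≤ C

end

/-!
# Cauchy's formula for polyanalytic functions in the exterior of a rectifiable curve

Let `F = ∑ F_n z̄ⁿ` be `(k + 1)`-analytic in `Ω₋`. For a fixed `z`, the function
`H(ζ) = ∑_m (conj (z - ζ))^m / m! · ∂_{ζ̄}^m F(ζ)` is the Taylor expansion of `F` in the
antiholomorphic variable alone, so that `H(ζ) = ∑ F_n(ζ) z̄ⁿ`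
(`sum_conj_sub_pow_mul_dbar_iterate`). Thus `H` is holomorphic in `Ω₋`, it is continuous up to `Γ`
because the derivatives `∂_{ζ̄}^m F` are, `H(z) = F(z)`, and `H(∞) = ∑ F_n(∞) z̄ⁿ`. The theorem is
Cauchy's integral formula for `H`. The components exist by induction on `k`
(`exists_isAnalyticComponents`), and their limits at `∞` by the removable singularity theorem.

What has to be proved is therefore Cauchy's formula in the exterior of a rectifiable Jordan curve
for functions that are merely continuous up to the curve (`eq_neg_contourIntegral_add`). It avoids
conformal maps and approximation of the curve:

* The Cauchy–Pompeiu formula `φ(w) = -π⁻¹ ∬ ∂_{ζ̄}φ(ζ) / (ζ - w)` and Fubini's theorem turn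
  `∫_Γ φ dζ` into the integral of `2i ∂_{ζ̄}φ` against the winding number of `Γ`. As `Γ` is a null
  set, this is Green's formula `∫_Γ φ dζ = -2i ∬_{Ω₋} ∂_{ζ̄}φ` for `φ` of class `C¹` with compact
  support (`contourIntegral_eq_integral_dbar`). The Jordan curve theorem is not needed.
* Let `f` be continuous on `ℂ` and holomorphic in `Ω₋`, and let `φ` be its mollification at scale
  `ε`. In `Ω₋`, `∂_{ζ̄}φ` vanishes at distance more than `ε` from `Γ`, and elsewhere it is at most
  a constant times `ω(ε) / ε`, where `ω` is the modulus of continuity of `f`. A curve of finite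
  length has an `ε`-neighbourhood of area `O(ε)` (`exists_volume_cthickening_le`), so the
  contribution of the neighbourhood of `Γ` to Green's formula tends to `0` with `ε`
  (`contourIntegral_eq_integral_mul_dbar_of_continuous`).
* What remains is the contribution of a cutoff function near `∞`, which is the residue of `f` there
  (`contourIntegral_eq_of_tendsto`). Applied to `f(ζ) = (g(ζ) - g(z)) / (ζ - z)`, this is Cauchy's
  formula for `g`.
-/

open MeasureTheory Metric
open scoped NNReal ENNReal Real ContDiff

/-! ### Absolutely continuous complex-valued functions -/

theorem AbsolutelyContinuousOnInterval.of_dist_le {X Y : Type*} [PseudoMetricSpace X]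
    [PseudoMetricSpace Y] {f : ℝ → X} {g : ℝ → Y} {a b K : ℝ}
    (hf : AbsolutelyContinuousOnInterval f a b)
    (h : ∀ s ∈ uIcc a b, ∀ t ∈ uIcc a b, dist (g s) (g t) ≤ K * dist (f s) (f t)) :
    AbsolutelyContinuousOnInterval g a b := by
  have h0 := Tendsto.const_mul K hf
  rw [mul_zero] at h0
  refine squeeze_zero' (Eventually.of_forall fun E => Finset.sum_nonneg fun i _ => dist_nonneg)
    ?_ h0
  rw [eventually_inf_principal]
  filter_upwards with E hE
  rw [Finset.mul_sum]
  exact Finset.sum_le_sum fun i hi => h _ (hE.1 i hi).1 _ (hE.1 i hi).2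

theorem AbsolutelyContinuousOnInterval.re {f : ℝ → ℂ} {a b : ℝ}
    (hf : AbsolutelyContinuousOnInterval f a b) :
    AbsolutelyContinuousOnInterval (fun t => (f t).re) a b :=
  hf.of_dist_le (K := 1) fun s _ t _ => by
    rw [one_mul, Real.dist_eq, Complex.dist_eq, ← Complex.sub_re]
    exact Complex.abs_re_le_norm _

theorem AbsolutelyContinuousOnInterval.im {f : ℝ → ℂ} {a b : ℝ}
    (hf : AbsolutelyContinuousOnInterval f a b) :
    AbsolutelyContinuousOnInterval (fun t => (f t).im) a b :=
  hf.of_dist_le (K := 1) fun s _ t _ => by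
    rw [one_mul, Real.dist_eq, Complex.dist_eq, ← Complex.sub_im]
    exact Complex.abs_im_le_norm _

theorem AbsolutelyContinuousOnInterval.ae_hasDerivAt_complex {f : ℝ → ℂ} {a b : ℝ}
    (hf : AbsolutelyContinuousOnInterval f a b) :
    ∀ᵐ t, t ∈ uIcc a b → HasDerivAt f
      (((deriv (fun t => (f t).re) t : ℝ) : ℂ) +
        ((deriv (fun t => (f t).im) t : ℝ) : ℂ) * Complex.I) t := by
  filter_upwards [hf.re.ae_differentiableAt, hf.im.ae_differentiableAt] with t h1 h2 ht
  have := (h1 ht).hasDerivAt.ofReal_comp.add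
    ((h2 ht).hasDerivAt.ofReal_comp.mul_const Complex.I)
  refine this.congr_of_eventuallyEq (Eventually.of_forall fun s => ?_)
  simp [Complex.re_add_im]

theorem AbsolutelyContinuousOnInterval.intervalIntegrable_deriv_complex {f : ℝ → ℂ} {a b : ℝ}
    (hf : AbsolutelyContinuousOnInterval f a b) :
    IntervalIntegrable (deriv f) volume a b := by
  have h1 : IntervalIntegrable (fun t => ((deriv (fun t => (f t).re) t : ℝ) : ℂ)) volume a b :=
    ⟨hf.re.intervalIntegrable_deriv.1.ofReal, hf.re.intervalIntegrable_deriv.2.ofReal⟩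
  have h2 : IntervalIntegrable
      (fun t => ((deriv (fun t => (f t).im) t : ℝ) : ℂ) * Complex.I) volume a b :=
    IntervalIntegrable.mul_const
      ⟨hf.im.intervalIntegrable_deriv.1.ofReal, hf.im.intervalIntegrable_deriv.2.ofReal⟩ _
  refine (h1.add h2).congr_ae ?_
  rw [Filter.EventuallyEq, ae_restrict_iff' measurableSet_uIoc]
  filter_upwards [hf.ae_hasDerivAt_complex] with t ht h
  exact (ht (uIoc_subset_uIcc h)).deriv.symm

/-- The fundamental theorem of calculus for absolutely continuous complex-valued functions. -/
theorem AbsolutelyContinuousOnInterval.integral_deriv_eq_sub_complex {f : ℝ → ℂ} {a b : ℝ}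
    (hf : AbsolutelyContinuousOnInterval f a b) :
    ∫ t in a..b, deriv f t = f b - f a := by
  have h1 : IntervalIntegrable (fun t => ((deriv (fun t => (f t).re) t : ℝ) : ℂ)) volume a b :=
    ⟨hf.re.intervalIntegrable_deriv.1.ofReal, hf.re.intervalIntegrable_deriv.2.ofReal⟩
  have h2 : IntervalIntegrable
      (fun t => ((deriv (fun t => (f t).im) t : ℝ) : ℂ) * Complex.I) volume a b :=
    IntervalIntegrable.mul_const
      ⟨hf.im.intervalIntegrable_deriv.1.ofReal, hf.im.intervalIntegrable_deriv.2.ofReal⟩ _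
  have : ∫ t in a..b, deriv f t = ∫ t in a..b, (((deriv (fun t => (f t).re) t : ℝ) : ℂ) +
      ((deriv (fun t => (f t).im) t : ℝ) : ℂ) * Complex.I) := by
    refine intervalIntegral.integral_congr_ae ?_
    filter_upwards [hf.ae_hasDerivAt_complex] with t ht h
    exact (ht (uIoc_subset_uIcc h)).deriv
  rw [this, intervalIntegral.integral_add h1 h2, intervalIntegral.integral_mul_const,
    intervalIntegral.integral_ofReal, intervalIntegral.integral_ofReal,
    hf.re.integral_deriv_eq_sub, hf.im.integral_deriv_eq_sub]
  apply Complex.ext <;> simp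

/-! ### Neighbourhoods of a rectifiable curve -/

/-- The closed `ε`-neighbourhood of a rectifiable curve of length `L` is covered by `L / ε + 1`
discs of radius `2 ε`, so that its area is `O(ε)`. -/
theorem exists_volume_cthickening_le {γ : ℝ → ℂ} {a b : ℝ} (hab : a ≤ b)
    (hγ : AbsolutelyContinuousOnInterval γ a b) :
    ∃ C : ℝ, 0 ≤ C ∧ ∀ ε : ℝ, 0 < ε → ε ≤ 1 →
      volume (cthickening ε (γ '' Icc a b)) ≤ ENNReal.ofReal (C * ε) := by
  -- The arc length.
  set S : ℝ → ℝ := fun t => ∫ s in a..t, ‖deriv γ s‖ with hS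
  have hint : ∀ s ∈ Icc a b, ∀ t ∈ Icc a b, IntervalIntegrable (deriv γ) volume s t := by
    intro s hs t ht
    refine hγ.intervalIntegrable_deriv_complex.mono_set ?_
    rw [uIcc_of_le hab]
    exact uIcc_subset_Icc hs ht
  have hdist : ∀ s ∈ Icc a b, ∀ t ∈ Icc a b, dist (γ s) (γ t) ≤ |S s - S t| := by
    intro s hs t ht
    have h1 : γ s - γ t = ∫ x in t..s, deriv γ x := by
      rw [(hγ.mono _).integral_deriv_eq_sub_complex]
      rw [uIcc_of_le hab]
      exact uIcc_subset_Icc ht hs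
    have h2 : S s - S t = ∫ x in t..s, ‖deriv γ x‖ := by
      rw [hS]
      exact intervalIntegral.integral_interval_sub_left
        (hint a (left_mem_Icc.2 hab) s hs).norm (hint a (left_mem_Icc.2 hab) t ht).norm
    rw [dist_eq_norm, h1, h2]
    exact intervalIntegral.norm_integral_le_abs_integral_norm
  have hSnn : ∀ t ∈ Icc a b, 0 ≤ S t := fun t ht =>
    intervalIntegral.integral_nonneg ht.1 fun _ _ => norm_nonneg _
  have hSle : ∀ t ∈ Icc a b, S t ≤ S b := fun t ht => by
    have : S b - S t = ∫ x in t..b, ‖deriv γ x‖ :=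
      intervalIntegral.integral_interval_sub_left
        (hint a (left_mem_Icc.2 hab) b (right_mem_Icc.2 hab)).norm
        (hint a (left_mem_Icc.2 hab) t ht).norm
    have := intervalIntegral.integral_nonneg (f := fun x => ‖deriv γ x‖) (μ := volume) ht.2
      fun _ _ => norm_nonneg _
    linarith
  have hL := hSnn b (right_mem_Icc.2 hab)
  refine ⟨4 * π * (S b + 1), by positivity, fun ε hε hε1 => ?_⟩
  have hcont : ContinuousOn γ (Icc a b) := by
    simpa [uIcc_of_le hab] using hγ.continuousOn
  -- For each `i`, a parameter whose arc length lies in `[i ε, (i + 1) ε)`, if there is one.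
  have hp : ∀ i : ℕ, ∃ p ∈ Icc a b, ∀ t ∈ Icc a b, ⌊S t / ε⌋₊ = i → ⌊S p / ε⌋₊ = i := by
    intro i
    by_cases h : ∃ t ∈ Icc a b, ⌊S t / ε⌋₊ = i
    · obtain ⟨t, ht, hti⟩ := h
      exact ⟨t, ht, fun _ _ _ => hti⟩
    · exact ⟨a, left_mem_Icc.2 hab, fun t ht hti => absurd ⟨t, ht, hti⟩ h⟩
  choose p hpm hpf using hp
  set N := ⌊S b / ε⌋₊ with hN
  have hsub : cthickening ε (γ '' Icc a b) ⊆
      ⋃ i ∈ Finset.range (N + 1), closedBall (γ (p i)) (2 * ε) := by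
    rw [(isCompact_Icc.image_of_continuousOn hcont).cthickening_eq_biUnion_closedBall hε.le]
    intro z hz
    simp only [mem_iUnion, exists_prop] at hz ⊢
    obtain ⟨_, ⟨t, ht, rfl⟩, hz⟩ := hz
    refine ⟨⌊S t / ε⌋₊, ?_, ?_⟩
    · rw [Finset.mem_range, Nat.lt_succ_iff]
      exact Nat.floor_le_floor (by gcongr; exact hSle t ht)
    · set i := ⌊S t / ε⌋₊ with hi
      have h1 := hpf i t ht rfl
      have e1 := Nat.floor_le (div_nonneg (hSnn t ht) hε.le)
      have e2 := Nat.lt_floor_add_one (S t / ε)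
      have e3 := Nat.floor_le (div_nonneg (hSnn _ (hpm i)) hε.le)
      have e4 := Nat.lt_floor_add_one (S (p i) / ε)
      rw [h1] at e3 e4
      rw [← hi] at e1 e2
      rw [le_div_iff₀ hε] at e1 e3
      rw [div_lt_iff₀ hε] at e2 e4
      have h2 : dist (γ t) (γ (p i)) ≤ ε := by
        refine (hdist t ht _ (hpm i)).trans ?_
        rw [abs_le]; constructor <;> nlinarith
      rw [mem_closedBall] at hz ⊢
      linarith [dist_triangle z (γ t) (γ (p i))]
  calc volume (cthickening ε (γ '' Icc a b))
      ≤ ∑ i ∈ Finset.range (N + 1), volume (closedBall (γ (p i)) (2 * ε)) :=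
        (measure_mono hsub).trans (measure_biUnion_finset_le _ _)
    _ = ENNReal.ofReal ((N + 1) * (π * (2 * ε) ^ 2)) := by
        simp only [Complex.volume_closedBall, Finset.sum_const, Finset.card_range, nsmul_eq_mul]
        have hpi : ENNReal.ofReal π = (NNReal.pi : ℝ≥0∞) := by
          rw [ENNReal.ofReal, Real.toNNReal_of_nonneg Real.pi_pos.le]
          rfl
        rw [ENNReal.ofReal_mul (p := (N : ℝ) + 1) (by positivity),
          ENNReal.ofReal_mul Real.pi_pos.le, ENNReal.ofReal_pow (by positivity), hpi,
          mul_comm (NNReal.pi : ℝ≥0∞), ← Nat.cast_succ, ENNReal.ofReal_natCast]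
    _ ≤ ENNReal.ofReal (4 * π * (S b + 1) * ε) := by
        refine ENNReal.ofReal_le_ofReal ?_
        have hNle : (N : ℝ) * ε ≤ S b := by
          rw [← le_div_iff₀ hε]; exact Nat.floor_le (by positivity)
        have : ((N : ℝ) + 1) * ε ≤ S b + 1 := by linarith
        nlinarith [mul_le_mul_of_nonneg_left this (by positivity : 0 ≤ 4 * π * ε)]

theorem volume_image_Icc_eq_zero {γ : ℝ → ℂ} {a b : ℝ} (hab : a ≤ b)
    (hγ : AbsolutelyContinuousOnInterval γ a b) : volume (γ '' Icc a b) = 0 := by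
  obtain ⟨C, hC, h⟩ := exists_volume_cthickening_le hab hγ
  have ht : Tendsto (fun ε : ℝ => ENNReal.ofReal (C * ε)) (𝓝[>] 0) (𝓝 0) := by
    have : Tendsto (fun ε : ℝ => ENNReal.ofReal (C * ε)) (𝓝 0) (𝓝 (ENNReal.ofReal (C * 0))) :=
      (ENNReal.continuous_ofReal.comp (continuous_const.mul continuous_id)).tendsto 0
    rw [mul_zero, ENNReal.ofReal_zero] at this
    exact this.mono_left nhdsWithin_le_nhds
  refine le_antisymm (ge_of_tendsto ht ?_) zero_le
  filter_upwards [Ioc_mem_nhdsGT (zero_lt_one (α := ℝ))] with ε hε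
  exact (measure_mono (self_subset_cthickening _)).trans (h ε hε.1 hε.2)

/-! ### The interior and the exterior of the curve -/

section Components

variable {γ : ℝ → ℂ} {a b : ℝ}

theorem IsRectifiableJordanCurve.continuousOn (hγ : IsRectifiableJordanCurve γ a b) :
    ContinuousOn γ (Icc a b) := by
  simpa [uIcc_of_le hγ.lt.le] using hγ.absolutelyContinuous.continuousOn

theorem IsRectifiableJordanCurve.isCompact_curveTrace (hγ : IsRectifiableJordanCurve γ a b) :
    IsCompact (curveTrace γ a b) :=
  isCompact_Icc.image_of_continuousOn hγ.continuousOn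

theorem IsPreconnected.subset_curveExterior {s : Set ℂ} (hs : IsPreconnected s)
    (hsub : s ⊆ (curveTrace γ a b)ᶜ) {z : ℂ} (hz : z ∈ s) (hz' : z ∈ curveExterior γ a b) :
    s ⊆ curveExterior γ a b := by
  intro w hw
  refine ⟨hsub hw, ?_⟩
  rw [← connectedComponentIn_eq (hs.subset_connectedComponentIn hz hsub hw)]
  exact hz'.2

theorem IsPreconnected.subset_curveInterior {s : Set ℂ} (hs : IsPreconnected s)
    (hsub : s ⊆ (curveTrace γ a b)ᶜ) {z : ℂ} (hz : z ∈ s) (hz' : z ∈ curveInterior γ a b) :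
    s ⊆ curveInterior γ a b := by
  intro w hw
  refine ⟨hsub hw, ?_⟩
  rw [← connectedComponentIn_eq (hs.subset_connectedComponentIn hz hsub hw)]
  exact hz'.2

theorem isOpen_curveExterior (hΓ : IsClosed (curveTrace γ a b)) :
    IsOpen (curveExterior γ a b) := by
  rw [Metric.isOpen_iff]
  intro z hz
  obtain ⟨ε, hε, h⟩ := Metric.isOpen_iff.1 hΓ.isOpen_compl z hz.1
  exact ⟨ε, hε, (isPreconnected_ball).subset_curveExterior h (mem_ball_self hε) hz⟩

theorem isOpen_curveInterior (hΓ : IsClosed (curveTrace γ a b)) :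
    IsOpen (curveInterior γ a b) := by
  rw [Metric.isOpen_iff]
  intro z hz
  obtain ⟨ε, hε, h⟩ := Metric.isOpen_iff.1 hΓ.isOpen_compl z hz.1
  exact ⟨ε, hε, (isPreconnected_ball).subset_curveInterior h (mem_ball_self hε) hz⟩

theorem compl_curveInterior :
    (curveInterior γ a b)ᶜ = curveExterior γ a b ∪ curveTrace γ a b := by
  ext z
  simp only [curveInterior, curveExterior, mem_compl_iff, mem_ofPred_eq, mem_union]
  tauto

theorem isClosed_curveExterior_union_curveTrace (hΓ : IsClosed (curveTrace γ a b)) :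
    IsClosed (curveExterior γ a b ∪ curveTrace γ a b) := by
  rw [← compl_curveInterior]
  exact (isOpen_curveInterior hΓ).isClosed_compl

theorem isPreconnected_setOf_lt_norm {R : ℝ} (hR : 0 ≤ R) :
    IsPreconnected {z : ℂ | R < ‖z‖} := by
  have h : {z : ℂ | R < ‖z‖} =
      (fun p : ℝ × ℝ => (p.1 : ℂ) * Complex.exp (p.2 * Complex.I)) '' (Ioi R ×ˢ univ) := by
    ext z
    simp only [mem_ofPred_eq, mem_image, mem_prod, mem_Ioi, mem_univ, and_true, Prod.exists]
    constructor
    · exact fun hz => ⟨‖z‖, z.arg, hz, Complex.norm_mul_exp_arg_mul_I z⟩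
    · rintro ⟨r, θ, hr, rfl⟩
      rwa [norm_mul, Complex.norm_exp_ofReal_mul_I, mul_one, Complex.norm_real,
        Real.norm_of_nonneg (hR.trans hr.le)]
  rw [h]
  refine (isPreconnected_Ioi.prod isPreconnected_univ).image _ (Continuous.continuousOn ?_)
  fun_prop

theorem mem_curveExterior_of_lt_norm {R : ℝ} (hR : 0 ≤ R)
    (hΓ : curveTrace γ a b ⊆ closedBall 0 R) {z : ℂ} (hz : R < ‖z‖) :
    z ∈ curveExterior γ a b := by
  have hsub : {z : ℂ | R < ‖z‖} ⊆ (curveTrace γ a b)ᶜ := by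
    intro w hw hw'
    have := hΓ hw'
    rw [mem_closedBall_zero_iff] at this
    exact absurd hw (not_lt.2 this)
  refine ⟨hsub hz, fun hb => ?_⟩
  have hb' := hb.subset ((isPreconnected_setOf_lt_norm hR).subset_connectedComponentIn hz hsub)
  obtain ⟨M, hM⟩ := hb'.exists_norm_le
  have h0 : 0 ≤ max M R := hR.trans (le_max_right _ _)
  have h1 : ‖((max M R + 1 : ℝ) : ℂ)‖ = max M R + 1 := by
    rw [Complex.norm_real, Real.norm_of_nonneg (by linarith)]
  have := hM ((max M R + 1 : ℝ) : ℂ) (by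
    rw [mem_ofPred_eq, h1]; linarith [le_max_right M R])
  rw [h1] at this
  linarith [le_max_left M R]

/-! ### The winding number vanishes in the exterior -/

/-- The integrand is the derivative of `-1 / (γ - z)`, which is absolutely continuous and takes the
same value at both ends of the closed curve. -/
theorem integral_inv_sub_sq_mul_deriv_eq_zero (hγ : IsRectifiableJordanCurve γ a b) {z : ℂ}
    (hz : z ∉ curveTrace γ a b) :
    ∫ t in a..b, ((γ t - z) ^ 2)⁻¹ * deriv γ t = 0 := by
  have hab := hγ.lt.le
  have hne : ∀ t ∈ Icc a b, γ t - z ≠ 0 := fun t ht h =>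
    hz ⟨t, ht, sub_eq_zero.1 h⟩
  have hc : ContinuousOn (fun t => (γ t - z)⁻¹) (Icc a b) :=
    (hγ.continuousOn.sub continuousOn_const).inv₀ hne
  obtain ⟨M, hM⟩ := isCompact_Icc.exists_bound_of_continuousOn hc
  have hac : AbsolutelyContinuousOnInterval (fun t => -(γ t - z)⁻¹) a b := by
    refine hγ.absolutelyContinuous.of_dist_le (K := M * M) fun s hs t ht => ?_
    rw [uIcc_of_le hab] at hs ht
    have e : -(γ s - z)⁻¹ - -(γ t - z)⁻¹ = (γ s - z)⁻¹ * (γ t - z)⁻¹ * (γ s - γ t) := by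
      have := hne s hs
      have := hne t ht
      field_simp
      ring
    rw [dist_eq_norm, dist_eq_norm, e, norm_mul, norm_mul]
    gcongr
    · exact (norm_nonneg _).trans (hM s hs)
    · exact hM s hs
    · exact hM t ht
  have h := hac.integral_deriv_eq_sub_complex
  rw [hγ.closed, sub_self] at h
  rw [← h]
  refine intervalIntegral.integral_congr_ae ?_
  filter_upwards [hγ.absolutelyContinuous.ae_hasDerivAt_complex] with t ht htm
  have htm' := uIoc_subset_uIcc htm
  have hd := (ht htm').differentiableAt.hasDerivAt
  rw [uIcc_of_le hab] at htm'
  have := ((hd.sub_const z).fun_inv (hne t htm')).fun_neg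
  rw [this.deriv]
  field_simp

theorem hasDerivAt_integral_inv_sub_mul_deriv (hγ : IsRectifiableJordanCurve γ a b) {z : ℂ}
    (hz : z ∉ curveTrace γ a b) :
    HasDerivAt (fun w => ∫ t in a..b, (γ t - w)⁻¹ * deriv γ t) 0 z := by
  have hab := hγ.lt.le
  have hint := hγ.absolutelyContinuous.intervalIntegrable_deriv_complex
  obtain ⟨ε, hε, hball⟩ := Metric.isOpen_iff.1 hγ.isCompact_curveTrace.isClosed.isOpen_compl z hz
  have hfar : ∀ t ∈ Icc a b, ∀ w ∈ ball z (ε / 2), ε / 2 ≤ ‖γ t - w‖ := by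
    intro t ht w hw
    by_contra! h
    refine hball (?_ : γ t ∈ ball z ε) ⟨t, ht, rfl⟩
    rw [← dist_eq_norm] at h
    rw [mem_ball] at hw ⊢
    linarith [dist_triangle (γ t) w z]
  have hne : ∀ t ∈ Icc a b, ∀ w ∈ ball z (ε / 2), γ t - w ≠ 0 := fun t ht w hw h => by
    have := hfar t ht w hw
    rw [h, norm_zero] at this
    linarith
  have hz2 : z ∈ ball z (ε / 2) := mem_ball_self (by positivity)
  have hi1 : ∀ w ∈ ball z (ε / 2),
      IntervalIntegrable (fun t => (γ t - w)⁻¹ * deriv γ t) volume a b := fun w hw =>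
    hint.continuousOn_mul (by
      rw [uIcc_of_le hab]
      exact (hγ.continuousOn.sub continuousOn_const).inv₀ fun t ht => hne t ht w hw)
  have hi2 : IntervalIntegrable (fun t => ((γ t - z) ^ 2)⁻¹ * deriv γ t) volume a b :=
    hint.continuousOn_mul (by
      rw [uIcc_of_le hab]
      exact ((hγ.continuousOn.sub continuousOn_const).pow 2).inv₀
        fun t ht => pow_ne_zero 2 (hne t ht z hz2))
  have hmeas : ∀ {f : ℝ → ℂ}, IntervalIntegrable f volume a b →
      AEStronglyMeasurable f (volume.restrict (uIoc a b)) := fun h => by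
    rw [uIoc_of_le hab]; exact h.aestronglyMeasurable
  have key := intervalIntegral.hasDerivAt_integral_of_dominated_loc_of_deriv_le
    (μ := volume) (F := fun w t => (γ t - w)⁻¹ * deriv γ t)
    (F' := fun w t => ((γ t - w) ^ 2)⁻¹ * deriv γ t) (x₀ := z) (s := ball z (ε / 2)) (a := a)
    (b := b) (bound := fun t => ((ε / 2) ^ 2)⁻¹ * ‖deriv γ t‖)
    (ball_mem_nhds z (by positivity)) ?_ (hi1 z hz2) (hmeas hi2) ?_
    (hint.norm.const_mul _) ?_
  · rw [← integral_inv_sub_sq_mul_deriv_eq_zero hγ hz]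
    exact key.2
  · filter_upwards [ball_mem_nhds z (by positivity : 0 < ε / 2)] with w hw
    exact hmeas (hi1 w hw)
  · refine Eventually.of_forall fun t ht w hw => ?_
    rw [uIoc_of_le hab] at ht
    have ht := Ioc_subset_Icc_self ht
    rw [norm_mul, norm_inv, norm_pow]
    gcongr
    exact hfar t ht w hw
  · refine Eventually.of_forall fun t ht w hw => ?_
    rw [uIoc_of_le hab] at ht
    have := hne t (Ioc_subset_Icc_self ht) w hw
    have h1 := (((hasDerivAt_id w).const_sub (γ t)).fun_inv this).mul_const (deriv γ t)
    simpa using h1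

/-- The winding number is locally constant off the curve and tends to `0` at `∞`. -/
theorem integral_inv_sub_mul_deriv_eq_zero (hγ : IsRectifiableJordanCurve γ a b) {z : ℂ}
    (hz : z ∈ curveExterior γ a b) :
    ∫ t in a..b, (γ t - z)⁻¹ * deriv γ t = 0 := by
  have hab := hγ.lt.le
  set V := connectedComponentIn (curveTrace γ a b)ᶜ z with hV
  have hΓc := hγ.isCompact_curveTrace
  have hVo : IsOpen V := hΓc.isClosed.isOpen_compl.connectedComponentIn
  have hVsub : V ⊆ (curveTrace γ a b)ᶜ := connectedComponentIn_subset _ _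
  have hconst : ∀ w ∈ V, ∫ t in a..b, (γ t - w)⁻¹ * deriv γ t =
      ∫ t in a..b, (γ t - z)⁻¹ * deriv γ t := by
    intro w hw
    refine hVo.is_const_of_deriv_eq_zero isPreconnected_connectedComponentIn
      (f := fun w => ∫ t in a..b, (γ t - w)⁻¹ * deriv γ t) ?_ ?_ hw
      (mem_connectedComponentIn hz.1)
    · exact fun u hu => (hasDerivAt_integral_inv_sub_mul_deriv hγ
        (hVsub hu)).differentiableAt.differentiableWithinAt
    · exact fun u hu => (hasDerivAt_integral_inv_sub_mul_deriv hγ (hVsub hu)).deriv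
  obtain ⟨M, hM⟩ := hΓc.isBounded.exists_norm_le
  set L := ∫ t in a..b, ‖deriv γ t‖ with hL
  have hint := hγ.absolutelyContinuous.intervalIntegrable_deriv_complex
  have hL0 : 0 ≤ L := intervalIntegral.integral_nonneg hab fun _ _ => norm_nonneg _
  by_contra h0
  set W := ∫ t in a..b, (γ t - z)⁻¹ * deriv γ t with hW
  have hW0 : 0 < ‖W‖ := norm_pos_iff.2 h0
  have hub : ∃ w ∈ V, M + (L + 1) / ‖W‖ < ‖w‖ := by
    by_contra! hcon
    exact hz.2 (isBounded_iff_forall_norm_le.2 ⟨_, hcon⟩)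
  obtain ⟨w, hwV, hw⟩ := hub
  have hle : ‖W‖ ≤ ((L + 1) / ‖W‖)⁻¹ * L := by
    have h3 : 0 < (L + 1) / ‖W‖ := by positivity
    calc ‖W‖ = ‖∫ t in a..b, (γ t - w)⁻¹ * deriv γ t‖ := by rw [hconst w hwV]
      _ ≤ ∫ t in a..b, ((L + 1) / ‖W‖)⁻¹ * ‖deriv γ t‖ := by
        refine intervalIntegral.norm_integral_le_of_norm_le hab ?_ (hint.norm.const_mul _)
        refine Eventually.of_forall fun t ht => ?_
        rw [norm_mul, norm_inv]
        have h1 := hM (γ t) ⟨t, Ioc_subset_Icc_self ht, rfl⟩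
        have h2 : (L + 1) / ‖W‖ ≤ ‖γ t - w‖ := by
          rw [norm_sub_rev]
          linarith [norm_sub_norm_le w (γ t)]
        exact mul_le_mul_of_nonneg_right (inv_anti₀ h3 h2) (norm_nonneg _)
      _ = ((L + 1) / ‖W‖)⁻¹ * L := by rw [intervalIntegral.integral_const_mul]
  rw [inv_div, div_mul_eq_mul_div, le_div_iff₀ (by positivity)] at hle
  nlinarith

end Components

/-! ### The Cauchy–Pompeiu formula -/

theorem continuous_dbar {φ : ℂ → ℂ} (hφ : ContDiff ℝ 1 φ) : Continuous (dbar φ) := by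
  have := hφ.continuous_fderiv one_ne_zero
  unfold dbar
  fun_prop

theorem hasCompactSupport_dbar {φ : ℂ → ℂ} (hc : HasCompactSupport φ) :
    HasCompactSupport (dbar φ) :=
  (hc.fderiv ℝ).comp_left (g := fun A : ℂ →L[ℝ] ℂ => (A 1 + Complex.I * A Complex.I) / 2)
    (by simp)

/-- The real-linear map `v ↦ A v + B v̄` has `B = ∂_{z̄}`; evaluation at `v = e` and `v = i e`
isolates `B`. -/
theorem dbar_mul_conj (φ : ℂ → ℂ) (z e : ℂ) :
    dbar φ z * starRingEnd ℂ e =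
      (fderiv ℝ φ z e + Complex.I * fderiv ℝ φ z (Complex.I * e)) / 2 := by
  set A := fderiv ℝ φ z
  have h : ∀ v : ℂ, A v = (v.re : ℂ) * A 1 + (v.im : ℂ) * A Complex.I := fun v => by
    conv_lhs => rw [show v = v.re • (1 : ℂ) + v.im • Complex.I by
      apply Complex.ext <;> simp]
    rw [map_add, map_smul, map_smul, Complex.real_smul, Complex.real_smul]
  rw [h e, h (Complex.I * e), show dbar φ z = (A 1 + Complex.I * A Complex.I) / 2 from rfl]
  have hc : starRingEnd ℂ e = e.re - e.im * Complex.I := by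
    apply Complex.ext <;> simp
  rw [hc]
  simp only [Complex.mul_re, Complex.mul_im, Complex.I_re, Complex.I_im, zero_mul, one_mul,
    zero_sub, zero_add, Complex.ofReal_neg]
  linear_combination (-(e.im : ℂ) * A Complex.I / 2) * Complex.I_sq

theorem integral_fderiv_eq_zero {φ : ℂ → ℂ} (hφ : ContDiff ℝ 1 φ) (hc : HasCompactSupport φ)
    (v : ℂ) : ∫ z, fderiv ℝ φ z v = 0 := by
  have hcont : Continuous fun z => fderiv ℝ φ z v := by
    have := hφ.continuous_fderiv one_ne_zero
    fun_prop
  have hcs : HasCompactSupport fun z => fderiv ℝ φ z v :=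
    (hc.fderiv ℝ).comp_left (g := fun A : ℂ →L[ℝ] ℂ => A v) (by simp)
  have := integral_mul_fderiv_eq_neg_fderiv_mul_of_integrable (μ := volume) (𝕜 := ℂ)
    (f := fun _ : ℂ => (1 : ℂ)) (g := φ) (v := v) (by simp)
    (by simpa using hcont.integrable_of_hasCompactSupport hcs)
    (by simpa using hφ.continuous.integrable_of_hasCompactSupport hc)
    (fun x _ => differentiableAt_const _)
    (fun x _ => (hφ.differentiable one_ne_zero).differentiableAt)
  simpa using this

theorem integral_dbar_eq_zero {φ : ℂ → ℂ} (hφ : ContDiff ℝ 1 φ) (hc : HasCompactSupport φ) :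
    ∫ z, dbar φ z = 0 := by
  have hi : ∀ v, Integrable fun z => fderiv ℝ φ z v := fun v => by
    refine Continuous.integrable_of_hasCompactSupport ?_
      ((hc.fderiv ℝ).comp_left (g := fun A : ℂ →L[ℝ] ℂ => A v) (by simp))
    have := hφ.continuous_fderiv one_ne_zero
    fun_prop
  unfold dbar
  rw [integral_div, integral_add (hi 1) ((hi _).const_mul _), integral_const_mul,
    integral_fderiv_eq_zero hφ hc, integral_fderiv_eq_zero hφ hc]
  simp

/-- The **Cauchy–Pompeiu formula** at the origin, in polar coordinates: `∂_{z̄} φ / z` is the sum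
of a radial derivative, whose integral is the value at `0`, and an angular derivative, whose
integral over each circle vanishes. -/
theorem integral_dbar_mul_inv_zero {φ : ℂ → ℂ} (hφ : ContDiff ℝ 1 φ) (hc : HasCompactSupport φ) :
    ∫ ζ, dbar φ ζ * ζ⁻¹ = -(π * φ 0) := by
  obtain ⟨ρ₀, hρ₀⟩ := hc.isCompact.isBounded.subset_closedBall (0 : ℂ)
  set ρ := max ρ₀ 0 with hρ
  have hρ0 : 0 ≤ ρ := le_max_right _ _
  have hsupp : ∀ z : ℂ, ρ < ‖z‖ → φ z = 0 ∧ fderiv ℝ φ z = 0 := by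
    intro z hz
    have hz' : z ∉ tsupport φ := fun h => by
      have := hρ₀ h
      rw [mem_closedBall_zero_iff] at this
      exact absurd hz (not_lt.2 (this.trans (le_max_left _ _)))
    refine ⟨image_eq_zero_of_notMem_tsupport hz', ?_⟩
    exact image_eq_zero_of_notMem_tsupport fun h => hz' (tsupport_fderiv_subset ℝ h)
  set e : ℝ → ℂ := fun θ => Complex.exp (θ * Complex.I) with he
  have hecont : Continuous e := by fun_prop
  have hene : ∀ θ, ‖e θ‖ = 1 := fun θ => Complex.norm_exp_ofReal_mul_I θ
  have hnorm : ∀ r θ : ℝ, 0 ≤ r → ‖(r : ℂ) * e θ‖ = r := fun r θ hr => by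
    rw [norm_mul, hene, mul_one, Complex.norm_real, Real.norm_of_nonneg hr]
  -- The radial and the angular part of the integrand.
  set A : ℝ × ℝ → ℂ := fun p => fderiv ℝ φ (p.1 * e p.2) (e p.2) with hA
  set B : ℝ × ℝ → ℂ := fun p => fderiv ℝ φ (p.1 * e p.2) (Complex.I * e p.2) with hB
  have hfd := hφ.continuous_fderiv one_ne_zero
  have hAc : Continuous A := by fun_prop
  have hBc : Continuous B := by fun_prop
  have hA0 : ∀ r θ : ℝ, 0 < r → ρ < r → A (r, θ) = 0 := fun r θ h1 h2 => by
    simp only [hA]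
    rw [(hsupp _ (by rw [hnorm r θ h1.le]; exact h2)).2]; rfl
  have hB0 : ∀ r θ : ℝ, 0 < r → ρ < r → B (r, θ) = 0 := fun r θ h1 h2 => by
    simp only [hB]
    rw [(hsupp _ (by rw [hnorm r θ h1.le]; exact h2)).2]; rfl
  have hint : ∀ g : ℝ × ℝ → ℂ, Continuous g → (∀ r θ : ℝ, 0 < r → ρ < r → g (r, θ) = 0) →
      IntegrableOn g (Ioi 0 ×ˢ Ioo (-π) π) := by
    intro g hg h0
    refine IntegrableOn.of_forall_sdiff_eq_zero (s := Icc 0 ρ ×ˢ Icc (-π) π)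
      (hg.continuousOn.integrableOn_compact (isCompact_Icc.prod isCompact_Icc))
      (measurableSet_Ioi.prod measurableSet_Ioo) ?_
    rintro ⟨r, θ⟩ ⟨⟨hr, hθ⟩, hn⟩
    refine h0 r θ hr ?_
    by_contra! h
    exact hn ⟨⟨le_of_lt hr, h⟩, Ioo_subset_Icc_self hθ⟩
  have hAi := hint A hAc hA0
  have hBi := hint B hBc hB0
  have hderiv_r : ∀ r θ : ℝ, HasDerivAt (fun r : ℝ => φ (r * e θ)) (A (r, θ)) r := by
    intro r θ
    have h1 : HasDerivAt (fun r : ℝ => (r : ℂ) * e θ) (e θ) r := by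
      simpa using (Complex.ofRealCLM.hasDerivAt (x := r)).mul_const (e θ)
    exact ((hφ.differentiable one_ne_zero) _).hasFDerivAt.comp_hasDerivAt r h1
  have hderiv_θ : ∀ r θ : ℝ, HasDerivAt (fun θ : ℝ => φ (r * e θ)) (r * B (r, θ)) θ := by
    intro r θ
    have h1 : HasDerivAt (fun θ : ℝ => (r : ℂ) * e θ) (r * (Complex.I * e θ)) θ := by
      have h2 : HasDerivAt (fun θ : ℝ => (θ : ℂ) * Complex.I) Complex.I θ := by
        simpa using (Complex.ofRealCLM.hasDerivAt (x := θ)).mul_const Complex.I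
      have h3 := h2.cexp.const_mul (r : ℂ)
      rwa [mul_comm (Complex.exp _) Complex.I] at h3
    have h4 := ((hφ.differentiable one_ne_zero) _).hasFDerivAt.comp_hasDerivAt θ h1
    have h5 : fderiv ℝ φ (r * e θ) (r * (Complex.I * e θ)) = r * B (r, θ) := by
      rw [← Complex.real_smul (x := r) (z := Complex.I * e θ), map_smul, Complex.real_smul]
    rwa [h5] at h4
  have hIA : ∫ p in Ioi (0 : ℝ) ×ˢ Ioo (-π) π, A p = -(2 * π * φ 0) := by
    have hi := hAi
    rw [IntegrableOn, Measure.volume_eq_prod, ← Measure.prod_restrict] at hi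
    rw [Measure.volume_eq_prod, ← Measure.prod_restrict, integral_prod_symm _ hi]
    have hin : ∀ θ : ℝ, ∫ r in Ioi (0 : ℝ), A (r, θ) = -φ 0 := by
      intro θ
      rw [integral_Ioi_of_hasDerivAt_of_tendsto' (f := fun r : ℝ => φ (r * e θ)) (m := 0)
        (fun r _ => hderiv_r r θ)]
      · simp
      · refine IntegrableOn.of_forall_sdiff_eq_zero (s := Icc 0 ρ) ?_ measurableSet_Ioi ?_
        · exact (Continuous.continuousOn (by fun_prop)).integrableOn_Icc
        · rintro r ⟨hr, hn⟩
          refine hA0 r θ hr ?_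
          by_contra! h
          exact hn ⟨le_of_lt hr, h⟩
      · refine tendsto_const_nhds.congr' ?_
        filter_upwards [eventually_gt_atTop ρ] with r hr
        exact ((hsupp _ (by rw [hnorm r θ (hρ0.trans hr.le)]; exact hr)).1).symm
    simp only [hin]
    rw [setIntegral_const, Measure.real, Real.volume_Ioo,
      ENNReal.toReal_ofReal (by linarith [Real.pi_pos]), Complex.real_smul]
    push_cast
    ring
  have hIB : ∫ p in Ioi (0 : ℝ) ×ˢ Ioo (-π) π, B p = 0 := by
    have hi := hBi
    rw [Measure.volume_eq_prod] at hi ⊢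
    rw [setIntegral_prod _ hi]
    refine (setIntegral_congr_fun measurableSet_Ioi fun r hr => ?_).trans (integral_zero _ _)
    have hr' : (r : ℂ) ≠ 0 := by exact_mod_cast (ne_of_gt hr)
    have h1 : ∫ θ in (-π)..π, r * B (r, θ) = 0 := by
      rw [intervalIntegral.integral_eq_sub_of_hasDerivAt (fun θ _ => hderiv_θ r θ)]
      · simp [he, Complex.exp_neg, Complex.exp_pi_mul_I]
      · exact (by fun_prop : Continuous fun θ : ℝ => (r : ℂ) * B (r, θ)).intervalIntegrable _ _
    rw [intervalIntegral.integral_const_mul, mul_eq_zero, or_iff_right hr',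
      intervalIntegral.integral_of_le (by linarith [Real.pi_pos]),
      integral_Ioc_eq_integral_Ioo] at h1
    simpa using h1
  rw [← Complex.integral_comp_polarCoord_symm]
  have hcongr : ∫ p in polarCoord.target, p.1 • (dbar φ (Complex.polarCoord.symm p) *
      (Complex.polarCoord.symm p)⁻¹) =
      ∫ p in Ioi (0 : ℝ) ×ˢ Ioo (-π) π, (A p + Complex.I * B p) / 2 := by
    refine setIntegral_congr_fun (measurableSet_Ioi.prod measurableSet_Ioo) ?_
    rintro ⟨r, θ⟩ ⟨hr, -⟩
    have hr' : (r : ℂ) ≠ 0 := by exact_mod_cast (ne_of_gt hr)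
    have hsymm : Complex.polarCoord.symm (r, θ) = r * e θ := by
      rw [Complex.polarCoord_symm_apply, he]
      simp only [Complex.exp_mul_I, Complex.ofReal_cos, Complex.ofReal_sin]
    have hinv : (e θ)⁻¹ = starRingEnd ℂ (e θ) := by
      rw [Complex.inv_def, Complex.normSq_eq_norm_sq, hene]; simp
    simp only [hsymm, hA, hB]
    rw [← dbar_mul_conj, mul_inv, hinv, Complex.real_smul]
    field_simp
  rw [hcongr, integral_div, integral_add hAi (hBi.const_mul _), integral_const_mul, hIA, hIB]
  ring

/-- The **Cauchy–Pompeiu formula** for compactly supported functions. -/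
theorem integral_dbar_mul_inv_sub {φ : ℂ → ℂ} (hφ : ContDiff ℝ 1 φ) (hc : HasCompactSupport φ)
    (w : ℂ) : ∫ ζ, dbar φ ζ * (ζ - w)⁻¹ = -(π * φ w) := by
  have h1 : ContDiff ℝ 1 fun z => φ (z + w) := hφ.comp (contDiff_id.add contDiff_const)
  have h2 : HasCompactSupport fun z => φ (z + w) := hc.comp_homeomorph (Homeomorph.addRight w)
  have h3 : ∀ z, dbar (fun z => φ (z + w)) z = dbar φ (z + w) := fun z => by
    unfold dbar
    rw [fderiv_comp_add_right]
  have := integral_dbar_mul_inv_zero h1 h2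
  simp only [h3, zero_add] at this
  rw [← this, ← integral_add_right_eq_self (μ := volume) _ w]
  simp

/-! ### Green's formula -/

theorem integrable_indicator_ball_inv_norm (r : ℝ) :
    Integrable ((ball (0 : ℂ) r).indicator fun ζ => ‖ζ‖⁻¹) := by
  rw [integrable_indicator_iff measurableSet_ball]
  rcases le_or_gt r 0 with hr | hr
  · rw [ball_eq_empty.2 hr]; exact integrableOn_empty
  rw [integrableOn_fun_norm_addHaar (μ := volume) (f := fun y : ℝ => y⁻¹)]
  have : IntegrableOn (fun _ : ℝ => (1 : ℝ)) (Ioo 0 r) := by simp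
  refine this.congr_fun (fun y hy => ?_) measurableSet_Ioo
  have : y ≠ 0 := hy.1.ne'
  simp [Complex.finrank_real_complex, this]

section Green

variable {γ : ℝ → ℂ} {a b : ℝ}

/-- Fubini's theorem applies to the Cauchy kernel along a rectifiable curve, since `1 / |ζ|` is
locally integrable in the plane. -/
theorem integrable_cauchyKernel (hγ : IsRectifiableJordanCurve γ a b) {u : ℂ → ℂ}
    (hu : Continuous u) (hc : HasCompactSupport u) :
    Integrable (fun p : ℝ × ℂ => u p.2 * (p.2 - γ p.1)⁻¹ * deriv γ p.1)
      ((volume.restrict (Ioc a b)).prod volume) := by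
  have hab := hγ.lt.le
  have hint : IntegrableOn (deriv γ) (Ioc a b) :=
    hγ.absolutelyContinuous.intervalIntegrable_deriv_complex.1
  have hγm : AEStronglyMeasurable γ (volume.restrict (Ioc a b)) :=
    (hγ.continuousOn.mono Ioc_subset_Icc_self).aestronglyMeasurable measurableSet_Ioc
  obtain ⟨M, hM⟩ := hγ.isCompact_curveTrace.isBounded.exists_norm_le
  obtain ⟨ρ, hρ⟩ := hc.isCompact.isBounded.exists_norm_le
  obtain ⟨D, hD⟩ := hc.exists_bound_of_continuous hu
  set k : ℂ → ℝ := (ball (0 : ℂ) (ρ + M + 1)).indicator fun ζ => ‖ζ‖⁻¹ with hk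
  have hki : Integrable k := integrable_indicator_ball_inv_norm _
  have hk0 : ∀ ζ, 0 ≤ k ζ := fun ζ => indicator_nonneg (fun _ _ => by positivity) ζ
  have hbd : ∀ w ∈ curveTrace γ a b, ∀ ζ, ‖u ζ * (ζ - w)⁻¹‖ ≤ D * k (ζ - w) := by
    intro w hw ζ
    by_cases hζ : ζ ∈ tsupport u
    · have h1 : ζ - w ∈ ball (0 : ℂ) (ρ + M + 1) := by
        rw [mem_ball_zero_iff]
        linarith [norm_sub_le ζ w, hρ ζ hζ, hM w hw]
      rw [hk, indicator_of_mem h1, norm_mul, norm_inv]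
      gcongr
      exact hD ζ
    · rw [image_eq_zero_of_notMem_tsupport hζ, zero_mul, norm_zero]
      exact mul_nonneg ((norm_nonneg _).trans (hD 0)) (hk0 _)
  have hmeas : AEStronglyMeasurable (fun p : ℝ × ℂ => u p.2 * (p.2 - γ p.1)⁻¹ * deriv γ p.1)
      ((volume.restrict (Ioc a b)).prod volume) := by
    have h1 : AEStronglyMeasurable (fun p : ℝ × ℂ => γ p.1)
        ((volume.restrict (Ioc a b)).prod volume) := hγm.comp_fst
    have h2 : AEStronglyMeasurable (fun p : ℝ × ℂ => deriv γ p.1)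
        ((volume.restrict (Ioc a b)).prod volume) := hint.aestronglyMeasurable.comp_fst
    have h3 : AEStronglyMeasurable (fun p : ℝ × ℂ => (p.2 - γ p.1)⁻¹)
        ((volume.restrict (Ioc a b)).prod volume) :=
      ((continuous_snd.aestronglyMeasurable.sub h1).aemeasurable.inv).aestronglyMeasurable
    exact (((hu.comp continuous_snd).aestronglyMeasurable).mul h3).mul h2
  have hfib : ∀ t ∈ Ioc a b, Integrable fun ζ => u ζ * (ζ - γ t)⁻¹ := by
    intro t ht
    refine ((hki.comp_sub_right (γ t)).const_mul D).mono' ?_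
      (Eventually.of_forall (hbd _ ⟨t, Ioc_subset_Icc_self ht, rfl⟩))
    exact hu.aestronglyMeasurable.mul
      ((measurable_id.sub_const (γ t)).inv).aestronglyMeasurable
  rw [integrable_prod_iff hmeas]
  constructor
  · rw [ae_restrict_iff' measurableSet_Ioc]
    exact Eventually.of_forall fun t ht => (hfib t ht).mul_const (deriv γ t)
  · refine (hint.norm.const_mul (D * ∫ ζ, k ζ)).mono' hmeas.norm.integral_prod_right' ?_
    rw [ae_restrict_iff' measurableSet_Ioc]
    refine Eventually.of_forall fun t ht => ?_
    rw [Real.norm_of_nonneg (integral_nonneg fun _ => norm_nonneg _)]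
    simp only [norm_mul _ (deriv γ t)]
    rw [integral_mul_const]
    gcongr
    calc ∫ ζ, ‖u ζ * (ζ - γ t)⁻¹‖ ≤ ∫ ζ, D * k (ζ - γ t) := by
          refine integral_mono (hfib t ht).norm ((hki.comp_sub_right (γ t)).const_mul D) ?_
          exact hbd _ ⟨t, Ioc_subset_Icc_self ht, rfl⟩
      _ = D * ∫ ζ, k ζ := by
          rw [integral_const_mul, integral_sub_right_eq_self (μ := volume) k (γ t)]

/-- **Green's formula** for the exterior of a rectifiable Jordan curve. The Cauchy–Pompeiu formula
turns `∫_Γ φ dζ` into the integral of `2 i ∂_{z̄} φ` against the winding number, which is `1` on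
`Ω₊`, `0` on `Ω₋`, and is undefined only on the null set `Γ`. -/
theorem contourIntegral_eq_integral_dbar (hγ : IsRectifiableJordanCurve γ a b)
    (hor : IsPositivelyOriented γ a b) {φ : ℂ → ℂ} (hφ : ContDiff ℝ 1 φ)
    (hc : HasCompactSupport φ) :
    contourIntegral γ a b φ = -(2 * Complex.I * ∫ ζ in curveExterior γ a b, dbar φ ζ) := by
  have hab := hγ.lt.le
  have hu := continuous_dbar hφ
  have huc := hasCompactSupport_dbar hc
  have hui : Integrable (dbar φ) := hu.integrable_of_hasCompactSupport huc
  have hπ : (π : ℂ) ≠ 0 := by exact_mod_cast Real.pi_ne_zero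
  have hint := integrable_cauchyKernel hγ hu huc
  have hEo := isOpen_curveExterior hγ.isCompact_curveTrace.isClosed
  have h1 : -(π * contourIntegral γ a b φ) =
      ∫ t in Ioc a b, ∫ ζ, dbar φ ζ * (ζ - γ t)⁻¹ * deriv γ t := by
    rw [contourIntegral, intervalIntegral.integral_of_le hab, ← integral_const_mul, ← integral_neg]
    refine integral_congr_ae (Eventually.of_forall fun t => ?_)
    simp only
    rw [integral_mul_const, integral_dbar_mul_inv_sub hφ hc]
    ring
  have h2 : ∀ ζ, ∫ t in Ioc a b, dbar φ ζ * (ζ - γ t)⁻¹ * deriv γ t =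
      -(dbar φ ζ * ∫ t in a..b, (γ t - ζ)⁻¹ * deriv γ t) := by
    intro ζ
    rw [intervalIntegral.integral_of_le hab, ← integral_const_mul, ← integral_neg]
    refine integral_congr_ae (Eventually.of_forall fun t => ?_)
    simp only
    rw [← neg_sub (γ t) ζ, inv_neg]
    ring
  have hΓ0 : ∀ᵐ ζ : ℂ, ζ ∉ curveTrace γ a b := by
    rw [ae_iff]
    simpa only [not_not] using! volume_image_Icc_eq_zero hab hγ.absolutelyContinuous
  have h3 : ∀ᵐ ζ : ℂ, -(dbar φ ζ * ∫ t in a..b, (γ t - ζ)⁻¹ * deriv γ t) =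
      (2 * π * Complex.I) * ((curveExterior γ a b).indicator (dbar φ) ζ - dbar φ ζ) := by
    filter_upwards [hΓ0] with ζ hζ
    by_cases hE : ζ ∈ curveExterior γ a b
    · rw [integral_inv_sub_mul_deriv_eq_zero hγ hE, indicator_of_mem hE]
      simp
    · have hI : ζ ∈ curveInterior γ a b := by
        by_contra h
        have : ζ ∈ (curveInterior γ a b)ᶜ := h
        rw [compl_curveInterior] at this
        exact this.elim hE hζ
      have h := hor ζ hI
      simp only [contourIntegral, one_div] at h
      rw [indicator_of_notMem hE]
      have h' : ∫ t in a..b, (γ t - ζ)⁻¹ * deriv γ t = 2 * π * Complex.I := by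
        rw [inv_mul_eq_one₀ (by simp [hπ])] at h
        exact h.symm
      rw [h']
      ring
  rw [integral_integral_swap hint] at h1
  simp only [h2] at h1
  rw [integral_congr_ae h3, integral_const_mul, integral_sub
    (hui.indicator hEo.measurableSet) hui, integral_dbar_eq_zero hφ hc,
    integral_indicator hEo.measurableSet, sub_zero] at h1
  refine mul_left_cancel₀ hπ ?_
  linear_combination -h1

end Green

/-! ### Mollifiers and cutoff functions -/

theorem norm_dbar_le (φ : ℂ → ℂ) (z : ℂ) : ‖dbar φ z‖ ≤ ‖fderiv ℝ φ z‖ := by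
  unfold dbar
  have h1 := (fderiv ℝ φ z).le_opNorm 1
  have h2 := (fderiv ℝ φ z).le_opNorm Complex.I
  rw [norm_one, mul_one] at h1
  rw [Complex.norm_I, mul_one] at h2
  rw [norm_div, Complex.norm_ofNat, div_le_iff₀ two_pos]
  refine (norm_add_le _ _).trans ?_
  rw [norm_mul, Complex.norm_I, one_mul]
  linarith

theorem dbar_eq_zero_of_differentiableAt {φ : ℂ → ℂ} {z : ℂ} (h : DifferentiableAt ℂ φ z) :
    dbar φ z = 0 := by
  have h1 : fderiv ℝ φ z Complex.I = Complex.I * fderiv ℝ φ z 1 := by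
    rw [h.fderiv_restrictScalars ℝ, ContinuousLinearMap.coe_restrictScalars',
      ← smul_eq_mul Complex.I, ← map_smul, smul_eq_mul, mul_one]
  rw [dbar, h1]
  linear_combination (fderiv ℝ φ z 1 / 2) * Complex.I_mul_I

theorem Filter.EventuallyEq.dbar_eq {f g : ℂ → ℂ} {z : ℂ} (h : f =ᶠ[𝓝 z] g) :
    dbar f z = dbar g z := by
  rw [dbar, dbar, h.fderiv_eq]

theorem dbar_mul {f g : ℂ → ℂ} {z : ℂ} (hf : DifferentiableAt ℝ f z)
    (hg : DifferentiableAt ℝ g z) :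
    dbar (fun w => f w * g w) z = f z * dbar g z + dbar f z * g z := by
  simp only [dbar, fderiv_fun_mul hf hg, add_apply,
    smul_apply, smul_eq_mul]
  ring

theorem volume_real_closedBall (z : ℂ) {r : ℝ} (hr : 0 ≤ r) :
    volume.real (closedBall z r) = π * r ^ 2 := by
  rw [Measure.real, Complex.volume_closedBall, ENNReal.toReal_mul, ENNReal.toReal_pow,
    ENNReal.toReal_ofReal hr, ENNReal.coe_toReal, mul_comm]
  rfl

/-- Mollifiers supported in the disc of radius `ε`: the rescaled bumps `ε⁻² β(z / ε)`, whose
derivative is `O(ε⁻³)` with a constant independent of `ε`. -/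
theorem exists_mollifier : ∃ K : ℝ, 0 ≤ K ∧ ∀ ε : ℝ, 0 < ε → ∃ ρ : ℂ → ℝ,
    ContDiff ℝ 1 ρ ∧ Function.support ρ ⊆ ball 0 ε ∧ (∀ z, 0 ≤ ρ z) ∧ ∫ z, ρ z = 1 ∧
      ∀ z, ‖fderiv ℝ ρ z‖ ≤ K / ε ^ 3 := by
  let β : ContDiffBump (0 : ℂ) := ⟨1 / 2, 1, by norm_num, by norm_num⟩
  have hβ : ContDiff ℝ 1 (β.normed volume) := β.contDiff_normed (n := 1)
  obtain ⟨K, hK⟩ := (β.hasCompactSupport_normed (μ := volume).fderiv ℝ).exists_bound_of_continuous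
    (hβ.continuous_fderiv one_ne_zero)
  refine ⟨K, (norm_nonneg _).trans (hK 0), fun ε hε => ?_⟩
  refine ⟨fun z => (ε ^ 2)⁻¹ * β.normed volume (ε⁻¹ • z), ?_, ?_, ?_, ?_, ?_⟩
  · exact contDiff_const.mul (hβ.comp (contDiff_id.const_smul ε⁻¹))
  · intro z hz
    have h1 : ε⁻¹ • z ∈ Function.support (β.normed volume) := right_ne_zero_of_mul hz
    rw [β.support_normed_eq, mem_ball_zero_iff, norm_smul, norm_inv, Real.norm_of_nonneg hε.le]
      at h1
    rw [mem_ball_zero_iff]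
    have h2 : ε⁻¹ * ‖z‖ < 1 := h1
    rwa [inv_mul_lt_iff₀ hε, mul_one] at h2
  · intro z
    have := β.nonneg_normed (μ := volume) (ε⁻¹ • z)
    positivity
  · rw [integral_const_mul, Measure.integral_comp_smul, β.integral_normed,
      Complex.finrank_real_complex, inv_pow, inv_inv, abs_of_nonneg (by positivity)]
    simp [hε.ne']
  · intro z
    have hd : DifferentiableAt ℝ (fun z => β.normed volume (ε⁻¹ • z)) z :=
      ((hβ.comp (contDiff_id.const_smul ε⁻¹)).differentiable one_ne_zero) z
    rw [fderiv_const_mul hd, fderiv_comp_smul, norm_smul, norm_smul, norm_inv, norm_inv,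
      Real.norm_of_nonneg hε.le, Real.norm_of_nonneg (by positivity : 0 ≤ ε ^ 2)]
    calc (ε ^ 2)⁻¹ * (ε⁻¹ * ‖fderiv ℝ (β.normed volume) (ε⁻¹ • z)‖)
        ≤ (ε ^ 2)⁻¹ * (ε⁻¹ * K) := by gcongr; exact hK _
      _ = K / ε ^ 3 := by field_simp

/-- Cutoff functions of the disc of radius `R`: the rescaled bumps `β((ζ - z) / R)`, whose
`∂_{z̄}`-derivative is `O(1 / R)` with a constant independent of `R`. -/
theorem exists_cutoff : ∃ K : ℝ, 0 ≤ K ∧ ∀ (z : ℂ) (R : ℝ), 0 < R → ∃ χ : ℂ → ℂ,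
    ContDiff ℝ 1 χ ∧ HasCompactSupport χ ∧ (∀ ζ ∈ ball z R, χ ζ = 1) ∧
      (∀ ζ, ζ ∉ closedBall z (2 * R) → dbar χ ζ = 0) ∧ ∀ ζ, ‖dbar χ ζ‖ ≤ K / R := by
  let β : ContDiffBump (0 : ℂ) := ⟨1, 2, by norm_num, by norm_num⟩
  have hβ : ContDiff ℝ 1 (fun z => (β z : ℂ)) :=
    Complex.ofRealCLM.contDiff.comp (β.contDiff (n := 1))
  have hβc : HasCompactSupport (fun z => (β z : ℂ)) :=
    β.hasCompactSupport.comp_left (g := fun x : ℝ => (x : ℂ)) Complex.ofReal_zero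
  obtain ⟨K, hK⟩ := (hβc.fderiv ℝ).exists_bound_of_continuous (hβ.continuous_fderiv one_ne_zero)
  refine ⟨K, (norm_nonneg _).trans (hK 0), fun z R hR => ?_⟩
  set χ : ℂ → ℂ := fun ζ => (β (R⁻¹ • (ζ - z)) : ℂ) with hχ
  have hzero : ∀ ζ, ζ ∉ closedBall z (2 * R) → χ ζ = 0 := by
    intro ζ hζ
    rw [mem_closedBall, not_le, dist_eq_norm] at hζ
    have : β (R⁻¹ • (ζ - z)) = 0 := by
      refine β.zero_of_le_dist ?_
      rw [dist_zero_right, norm_smul, norm_inv, Real.norm_of_nonneg hR.le]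
      change 2 ≤ _
      rw [le_inv_mul_iff₀ hR]
      linarith
    rw [hχ]
    simp only [this, Complex.ofReal_zero]
  have hsub : ContDiff ℝ 1 fun ζ : ℂ => ζ - z := contDiff_id.sub contDiff_const
  refine ⟨χ, hβ.comp (hsub.const_smul R⁻¹), ?_, ?_, ?_, ?_⟩
  · exact HasCompactSupport.intro (isCompact_closedBall z (2 * R)) hzero
  · intro ζ hζ
    rw [mem_ball, dist_eq_norm] at hζ
    have : β (R⁻¹ • (ζ - z)) = 1 := by
      refine β.one_of_mem_closedBall ?_
      rw [mem_closedBall_zero_iff, norm_smul, norm_inv, Real.norm_of_nonneg hR.le]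
      change _ ≤ (1 : ℝ)
      rw [inv_mul_le_iff₀ hR]
      linarith
    rw [hχ]
    simp only [this, Complex.ofReal_one]
  · intro ζ hζ
    have h0 : χ =ᶠ[𝓝 ζ] fun _ => 0 := by
      filter_upwards [isClosed_closedBall.isOpen_compl.mem_nhds hζ] with w hw
      exact hzero w hw
    rw [h0.dbar_eq]
    exact dbar_eq_zero_of_differentiableAt (differentiableAt_const _)
  · intro ζ
    refine (norm_dbar_le _ _).trans ?_
    have h1 : fderiv ℝ χ ζ = R⁻¹ • fderiv ℝ (fun z => (β z : ℂ)) (R⁻¹ • (ζ - z)) := by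
      rw [← fderiv_comp_smul (f := fun z => (β z : ℂ)) (x := ζ - z) R⁻¹, ← fderiv_comp_sub z]
    rw [h1, norm_smul, norm_inv, Real.norm_of_nonneg hR.le, div_eq_inv_mul]
    gcongr
    exact hK _

section Mollify

open scoped Convolution
open ContinuousLinearMap (lsmul)

variable {ρ : ℂ → ℝ} {f : ℂ → ℂ} {ε : ℝ}

theorem hasCompactSupport_of_support_subset_ball (hs : Function.support ρ ⊆ ball 0 ε) :
    HasCompactSupport ρ :=
  HasCompactSupport.of_support_subset_isCompact (isCompact_closedBall 0 ε)
    (hs.trans ball_subset_closedBall)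

theorem contDiff_mollify (hρ : ContDiff ℝ 1 ρ) (hs : Function.support ρ ⊆ ball 0 ε)
    (hf : Continuous f) : ContDiff ℝ 1 (ρ ⋆[lsmul ℝ ℝ, volume] f) :=
  (hasCompactSupport_of_support_subset_ball hs).contDiff_convolution_left (n := 1) (lsmul ℝ ℝ)
    hρ hf.locallyIntegrable

/-- A mollified function has small derivative at points near which the function oscillates little,
because mollification commutes with subtracting a constant. -/
theorem norm_dbar_mollify_le (hρ : ContDiff ℝ 1 ρ) (hs : Function.support ρ ⊆ ball 0 ε)
    (hε : 0 ≤ ε) (hint : ∫ z, ρ z = 1) {M : ℝ} (hM : ∀ z, ‖fderiv ℝ ρ z‖ ≤ M)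
    (hf : Continuous f) {η : ℝ} {z : ℂ} (hz : ∀ w ∈ closedBall z ε, ‖f w - f z‖ ≤ η) :
    ‖dbar (ρ ⋆[lsmul ℝ ℝ, volume] f) z‖ ≤ M * η * (π * ε ^ 2) := by
  have hc := hasCompactSupport_of_support_subset_ball hs
  have hM0 : 0 ≤ M := (norm_nonneg _).trans (hM 0)
  set g : ℂ → ℂ := fun w => f w - f z with hg
  have hgc : Continuous g := hf.sub continuous_const
  have hsub : (ρ ⋆[lsmul ℝ ℝ, volume] f) = fun w => (ρ ⋆[lsmul ℝ ℝ, volume] g) w + f z := by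
    ext w
    have h1 := (hc.convolutionExists_left (lsmul ℝ ℝ) hρ.continuous
      (hgc.locallyIntegrable (μ := volume))) w
    have h2 : Integrable fun t => lsmul ℝ ℝ (ρ t) (f z) := by
      have : Integrable ρ := hρ.continuous.integrable_of_hasCompactSupport hc
      simpa using this.smul_const (f z)
    have h3 : ∫ t, lsmul ℝ ℝ (ρ t) (f z) = f z := by
      simp only [ContinuousLinearMap.lsmul_apply]
      rw [integral_smul_const, hint, one_smul]
    rw [convolution_def, convolution_def]
    conv_rhs => rw [← h3]
    rw [← integral_add h1 h2]
    refine integral_congr_ae (Eventually.of_forall fun t => ?_)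
    simp only [hg, ContinuousLinearMap.lsmul_apply, Complex.real_smul]
    ring
  have hd := hc.hasFDerivAt_convolution_left (lsmul ℝ ℝ) hρ
    (hgc.locallyIntegrable (μ := volume)) z
  refine (norm_dbar_le _ _).trans ?_
  rw [hsub, fderiv_add_const, hd.fderiv, convolution_def]
  have hts : tsupport (fderiv ℝ ρ) ⊆ closedBall 0 ε :=
    (tsupport_fderiv_subset ℝ).trans
      (closure_minimal (hs.trans ball_subset_closedBall) isClosed_closedBall)
  rw [← setIntegral_eq_integral_of_forall_compl_eq_zero (s := closedBall (0 : ℂ) ε)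
    (fun t ht => by rw [image_eq_zero_of_notMem_tsupport fun h => ht (hts h)]; simp)]
  rw [← volume_real_closedBall (0 : ℂ) hε]
  refine norm_setIntegral_le_of_norm_le_const measure_closedBall_lt_top fun t ht => ?_
  refine (ContinuousLinearMap.le_opNorm₂ _ _ _).trans ?_
  have h1 : ‖(lsmul ℝ ℝ : ℝ →L[ℝ] ℂ →L[ℝ] ℂ).precompL ℂ‖ ≤ 1 :=
    (ContinuousLinearMap.norm_precompL_le _ _).trans ContinuousLinearMap.opNorm_lsmul_le
  have h2 : ‖g (z - t)‖ ≤ η := by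
    refine hz _ ?_
    rw [mem_closedBall, dist_eq_norm]
    simpa using ht
  calc _ ≤ 1 * M * η := by gcongr; exact hM t
    _ = M * η := by ring

/-- Mollification preserves holomorphy. -/
theorem dbar_mollify_eq_zero (hρ : ContDiff ℝ 1 ρ) (hs : Function.support ρ ⊆ ball 0 ε)
    (hf : Continuous f) {U : Set ℂ} (hU : IsOpen U) (hfU : DifferentiableOn ℂ f U) {z : ℂ}
    (hz : closedBall z ε ⊆ U) : dbar (ρ ⋆[lsmul ℝ ℝ, volume] f) z = 0 := by
  have hc := hasCompactSupport_of_support_subset_ball hs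
  have hρi : Integrable ρ := hρ.continuous.integrable_of_hasCompactSupport hc
  obtain ⟨δ, hδ, hδU⟩ := (isCompact_closedBall z ε).exists_cthickening_subset_open hU hz
  have hT : IsCompact (cthickening δ (closedBall z ε)) := (isCompact_closedBall z ε).cthickening
  obtain ⟨M, hM⟩ := hT.exists_bound_of_continuousOn
    (((hfU.deriv hU).continuousOn).mono hδU)
  have hmem : ∀ t ∈ Function.support ρ, ∀ x ∈ ball z δ,
      x - t ∈ cthickening δ (closedBall z ε) := by
    intro t ht x hx
    refine mem_cthickening_of_dist_le (x - t) (z - t) δ _ ?_ ?_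
    · have := hs ht
      rw [mem_ball_zero_iff] at this
      rw [mem_closedBall, dist_eq_norm]
      simpa using this.le
    · rw [dist_sub_right]
      exact (mem_ball.1 hx).le
  have hconv : ∀ x, Integrable fun t => ρ t • f (x - t) := fun x =>
    (hc.convolutionExists_left (lsmul ℝ ℝ) hρ.continuous
      (hf.locallyIntegrable (μ := volume))) x
  have key := hasDerivAt_integral_of_dominated_loc_of_deriv_le (μ := volume)
    (F := fun x t => ρ t • f (x - t)) (F' := fun x t => ρ t • deriv f (x - t)) (x₀ := z)
    (s := ball z δ) (bound := fun t => ‖ρ t‖ * M) (ball_mem_nhds z hδ)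
    (Eventually.of_forall fun x => (hconv x).aestronglyMeasurable) (hconv z) ?_ ?_
    (hρi.norm.mul_const M) ?_
  · exact dbar_eq_zero_of_differentiableAt key.2.differentiableAt
  · exact hρ.continuous.aestronglyMeasurable.smul
      ((measurable_deriv f).comp (measurable_const.sub measurable_id)).aestronglyMeasurable
  · refine Eventually.of_forall fun t x hx => ?_
    by_cases ht : t ∈ Function.support ρ
    · rw [norm_smul]
      gcongr
      exact hM _ (hmem t ht x hx)
    · rw [Function.notMem_support.1 ht]
      simp
  · refine Eventually.of_forall fun t x hx => ?_
    by_cases ht : t ∈ Function.support ρ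
    · have h1 := (hfU.differentiableAt (hU.mem_nhds (hδU (hmem t ht x hx)))).hasDerivAt
      have h2 := h1.comp x ((hasDerivAt_id x).sub_const t)
      rw [mul_one] at h2
      exact h2.const_smul (ρ t)
    · simp only [Function.notMem_support.1 ht, zero_smul]
      exact hasDerivAt_const _ _

end Mollify

/-! ### Cauchy's integral formula in the exterior, up to the boundary -/

section CauchyExterior

open scoped Convolution
open ContinuousLinearMap (lsmul)

variable {γ : ℝ → ℂ} {a b : ℝ}

theorem intervalIntegrable_mul_deriv (hγ : IsRectifiableJordanCurve γ a b) {f : ℂ → ℂ}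
    (hf : ContinuousOn f (curveTrace γ a b)) :
    IntervalIntegrable (fun t => f (γ t) * deriv γ t) volume a b := by
  refine hγ.absolutelyContinuous.intervalIntegrable_deriv_complex.continuousOn_mul ?_
  rw [uIcc_of_le hγ.lt.le]
  exact hf.comp hγ.continuousOn fun t ht => ⟨t, ht, rfl⟩

theorem contourIntegral_congr (hab : a ≤ b) {f g : ℂ → ℂ}
    (h : ∀ ζ ∈ curveTrace γ a b, f ζ = g ζ) : contourIntegral γ a b f = contourIntegral γ a b g := by
  refine intervalIntegral.integral_congr fun t ht => ?_
  rw [uIcc_of_le hab] at ht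
  simp only [h (γ t) ⟨t, ht, rfl⟩]

theorem contourIntegral_sub (hγ : IsRectifiableJordanCurve γ a b) {f g : ℂ → ℂ}
    (hf : ContinuousOn f (curveTrace γ a b)) (hg : ContinuousOn g (curveTrace γ a b)) :
    contourIntegral γ a b (fun ζ => f ζ - g ζ) =
      contourIntegral γ a b f - contourIntegral γ a b g := by
  unfold contourIntegral
  rw [← intervalIntegral.integral_sub (intervalIntegrable_mul_deriv hγ hf)
    (intervalIntegrable_mul_deriv hγ hg)]
  simp only [sub_mul]

theorem norm_contourIntegral_le (hγ : IsRectifiableJordanCurve γ a b) {f : ℂ → ℂ} {η : ℝ}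
    (hf : ∀ ζ ∈ curveTrace γ a b, ‖f ζ‖ ≤ η) :
    ‖contourIntegral γ a b f‖ ≤ η * ∫ t in a..b, ‖deriv γ t‖ := by
  rw [contourIntegral, ← intervalIntegral.integral_const_mul]
  refine intervalIntegral.norm_integral_le_of_norm_le hγ.lt.le
    (Eventually.of_forall fun t ht => ?_)
    (hγ.absolutelyContinuous.intervalIntegrable_deriv_complex.norm.const_mul _)
  rw [norm_mul]
  gcongr
  exact hf _ ⟨t, Ioc_subset_Icc_self ht, rfl⟩

theorem eq_zero_of_forall_norm_le_mul {x : ℂ} {Q : ℝ} (h : ∀ η : ℝ, 0 < η → ‖x‖ ≤ η * Q) :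
    x = 0 := by
  have ht : Tendsto (fun η : ℝ => η * Q) (𝓝 0) (𝓝 (0 * Q)) :=
    (continuous_id.mul continuous_const).tendsto 0
  rw [zero_mul] at ht
  refine norm_le_zero_iff.1 (ge_of_tendsto (ht.mono_left nhdsWithin_le_nhds)
    (?_ : ∀ᶠ η in 𝓝[>] (0 : ℝ), _))
  filter_upwards [self_mem_nhdsWithin] with η hη using h η hη

/-- Green's formula for a function holomorphic in `Ω₋` and merely continuous up to `Γ`, cut off
by `χ`. Mollify a continuous extension `f` at scale `ε`. Then `∂_{z̄}` of the mollification
vanishes in `Ω₋` at distance more than `ε` from `Γ`, and nearer to `Γ` it is `o(1 / ε)`, on a set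
of area `O(ε)`. -/
theorem contourIntegral_eq_integral_mul_dbar_of_continuous (hγ : IsRectifiableJordanCurve γ a b)
    (hor : IsPositivelyOriented γ a b) {f χ : ℂ → ℂ} (hf : Continuous f)
    (hfE : DifferentiableOn ℂ f (curveExterior γ a b)) (hχ : ContDiff ℝ 1 χ)
    (hχc : HasCompactSupport χ) (hχ1 : ∀ ζ ∈ curveTrace γ a b, χ ζ = 1) :
    contourIntegral γ a b f =
      -(2 * Complex.I * ∫ ζ in curveExterior γ a b, f ζ * dbar χ ζ) := by
  have hab := hγ.lt.le
  have hΓc := hγ.isCompact_curveTrace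
  have hEo := isOpen_curveExterior hΓc.isClosed
  have hdχ := continuous_dbar hχ
  have hdχc := hasCompactSupport_dbar hχc
  have hdχi : Integrable (dbar χ) := hdχ.integrable_of_hasCompactSupport hdχc
  obtain ⟨K, hK0, hmoll⟩ := exists_mollifier
  obtain ⟨C, hC0, harea⟩ := exists_volume_cthickening_le hab hγ.absolutelyContinuous
  obtain ⟨B, hB⟩ := hχc.exists_bound_of_continuous hχ.continuous
  have hB0 : 0 ≤ B := (norm_nonneg _).trans (hB 0)
  set L := ∫ t in a..b, ‖deriv γ t‖ with hL
  set D := ∫ ζ, ‖dbar χ ζ‖ with hD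
  set Q := L + 2 * (B * K * π * C + D) with hQ
  set X := contourIntegral γ a b f + 2 * Complex.I * ∫ ζ in curveExterior γ a b, f ζ * dbar χ ζ
    with hX
  suffices hmain : ∀ η : ℝ, 0 < η → ‖X‖ ≤ η * Q from
    eq_neg_of_add_eq_zero_left (eq_zero_of_forall_norm_le_mul hmain)
  intro η hη
  -- On the compact set `T`, the scale `ε` makes `f` oscillate by at most `η`.
  set T := tsupport χ ∪ curveTrace γ a b with hT
  have hTc : IsCompact T := hχc.isCompact.union hΓc
  obtain ⟨δ, hδ, huc⟩ := Metric.mem_uniformity_dist.1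
    (hTc.uniformContinuousAt_of_continuousAt f (fun x _ => hf.continuousAt)
      (Metric.dist_mem_uniformity hη))
  set ε := min (δ / 2) 1 with hε
  have hε0 : 0 < ε := lt_min (by linarith) one_pos
  have hεδ : ε < δ := (min_le_left _ _).trans_lt (by linarith)
  have hclose : ∀ x ∈ T, ∀ y ∈ closedBall x ε, ‖f y - f x‖ ≤ η := by
    intro x hx y hy
    have h1 : dist x y < δ := by
      rw [dist_comm]; exact (mem_closedBall.1 hy).trans_lt hεδ
    have h2 : dist (f x) (f y) < η := huc h1 hx
    rw [dist_comm, dist_eq_norm] at h2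
    exact h2.le
  obtain ⟨ρ, hρ, hρs, hρ0, hρ1, hρK⟩ := hmoll ε hε0
  set φ : ℂ → ℂ := ρ ⋆[lsmul ℝ ℝ, volume] f with hφ
  have hφC : ContDiff ℝ 1 φ := contDiff_mollify hρ hρs hf
  have hφf : ∀ x ∈ T, ‖φ x - f x‖ ≤ η := by
    intro x hx
    rw [← dist_eq_norm]
    refine dist_convolution_le hη.le hρs hρ0 hρ1 hf.aestronglyMeasurable fun y hy => ?_
    rw [dist_eq_norm]
    exact hclose x hx y (ball_subset_closedBall hy)
  have hdφ : Continuous (dbar φ) := continuous_dbar hφC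
  have hG := contourIntegral_eq_integral_dbar hγ hor (hχ.mul hφC) (hχc.mul_right)
  have hi1 : Integrable fun ζ => χ ζ * dbar φ ζ :=
    (hχ.continuous.mul hdφ).integrable_of_hasCompactSupport hχc.mul_right
  have hi2 : Integrable fun ζ => dbar χ ζ * φ ζ :=
    (hdχ.mul hφC.continuous).integrable_of_hasCompactSupport hdχc.mul_right
  have hi3 : Integrable fun ζ => f ζ * dbar χ ζ :=
    (hf.mul hdχ).integrable_of_hasCompactSupport hdχc.mul_left
  have hdb : ∀ ζ, dbar (fun w => χ w * φ w) ζ = χ ζ * dbar φ ζ + dbar χ ζ * φ ζ := fun ζ =>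
    dbar_mul (hχ.differentiable one_ne_zero ζ) (hφC.differentiable one_ne_zero ζ)
  simp only [hdb] at hG
  rw [integral_add hi1.integrableOn hi2.integrableOn] at hG
  have hG' : contourIntegral γ a b φ = -(2 * Complex.I *
      ((∫ ζ in curveExterior γ a b, χ ζ * dbar φ ζ) +
        ∫ ζ in curveExterior γ a b, dbar χ ζ * φ ζ)) := by
    rw [← hG]
    refine contourIntegral_congr hab fun ζ hζ => ?_
    rw [hχ1 ζ hζ, one_mul]
  have hsplit : X = contourIntegral γ a b (fun ζ => f ζ - φ ζ) -
      2 * Complex.I * ((∫ ζ in curveExterior γ a b, χ ζ * dbar φ ζ) +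
        ∫ ζ in curveExterior γ a b, (φ ζ - f ζ) * dbar χ ζ) := by
    rw [contourIntegral_sub hγ hf.continuousOn hφC.continuous.continuousOn, hG', hX]
    have : ∫ ζ in curveExterior γ a b, (φ ζ - f ζ) * dbar χ ζ =
        (∫ ζ in curveExterior γ a b, dbar χ ζ * φ ζ) -
          ∫ ζ in curveExterior γ a b, f ζ * dbar χ ζ := by
      rw [← integral_sub hi2.integrableOn hi3.integrableOn]
      refine integral_congr_ae (Eventually.of_forall fun ζ => ?_)
      simp only
      ring
    rw [this]
    ring
  have hb1 : ‖contourIntegral γ a b (fun ζ => f ζ - φ ζ)‖ ≤ η * L :=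
    norm_contourIntegral_le hγ fun ζ hζ => by
      rw [norm_sub_rev]; exact hφf ζ (Or.inr hζ)
  have hb2 : ‖∫ ζ in curveExterior γ a b, (φ ζ - f ζ) * dbar χ ζ‖ ≤ η * D := by
    calc ‖∫ ζ in curveExterior γ a b, (φ ζ - f ζ) * dbar χ ζ‖
        ≤ ∫ ζ in curveExterior γ a b, η * ‖dbar χ ζ‖ := by
          refine norm_integral_le_of_norm_le (hdχi.norm.const_mul η).integrableOn
            (Eventually.of_forall fun ζ => ?_)
          rw [norm_mul]
          by_cases hζ : ζ ∈ tsupport χ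
          · gcongr
            exact hφf ζ (Or.inl hζ)
          · have h0 : χ =ᶠ[𝓝 ζ] fun _ => 0 := notMem_tsupport_iff_eventuallyEq.1 hζ
            rw [h0.dbar_eq, dbar_eq_zero_of_differentiableAt (differentiableAt_const _)]
            simp
      _ ≤ ∫ ζ, η * ‖dbar χ ζ‖ :=
          setIntegral_le_integral (hdχi.norm.const_mul η)
            (Eventually.of_forall fun ζ => by positivity)
      _ = η * D := integral_const_mul _ _
  have hb3 : ‖∫ ζ in curveExterior γ a b, χ ζ * dbar φ ζ‖ ≤ η * (B * K * π * C) := by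
    have hsub : curveExterior γ a b ∩ cthickening ε (curveTrace γ a b) ⊆ curveExterior γ a b :=
      inter_subset_left
    rw [setIntegral_eq_of_subset_of_forall_sdiff_eq_zero hEo.measurableSet hsub ?_]
    · have hvol := harea ε hε0 (min_le_right _ _)
      have hvol' : volume (curveExterior γ a b ∩ cthickening ε (curveTrace γ a b)) ≤
          ENNReal.ofReal (C * ε) := (measure_mono inter_subset_right).trans hvol
      have hreal : volume.real (curveExterior γ a b ∩ cthickening ε (curveTrace γ a b)) ≤
          C * ε := ENNReal.toReal_le_of_le_ofReal (by positivity) hvol'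
      calc _ ≤ B * (K / ε ^ 3 * η * (π * ε ^ 2)) *
            volume.real (curveExterior γ a b ∩ cthickening ε (curveTrace γ a b)) := by
            refine norm_setIntegral_le_of_norm_le_const
              (hvol'.trans_lt ENNReal.ofReal_lt_top) fun ζ hζ => ?_
            by_cases hζ' : ζ ∈ tsupport χ
            · rw [norm_mul]
              gcongr
              · exact hB ζ
              · exact norm_dbar_mollify_le hρ hρs hε0.le hρ1 hρK hf (hclose ζ (Or.inl hζ'))
            · rw [image_eq_zero_of_notMem_tsupport hζ', zero_mul, norm_zero]
              positivity
        _ ≤ B * (K / ε ^ 3 * η * (π * ε ^ 2)) * (C * ε) := by gcongr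
        _ = η * (B * K * π * C) := by field_simp
    · rintro ζ ⟨hζE, hζn⟩
      have hdisj : closedBall ζ ε ⊆ (curveTrace γ a b)ᶜ := by
        intro w hw hwΓ
        refine hζn ⟨hζE, mem_cthickening_of_dist_le ζ w ε _ hwΓ ?_⟩
        rw [dist_comm]
        exact hw
      have hE := (isPreconnected_closedBall).subset_curveExterior hdisj
        (mem_closedBall_self hε0.le) hζE
      rw [dbar_mollify_eq_zero hρ hρs hf hEo hfE hE, mul_zero]
  rw [hsplit, hQ]
  refine (norm_sub_le _ _).trans ?_
  rw [norm_mul, norm_mul, Complex.norm_I, Complex.norm_ofNat]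
  have := norm_add_le (∫ ζ in curveExterior γ a b, χ ζ * dbar φ ζ)
    (∫ ζ in curveExterior γ a b, (φ ζ - f ζ) * dbar χ ζ)
  linarith

/-- The previous formula for a function defined only on `Ω₋ ∪ Γ`, by Tietze's extension theorem. -/
theorem contourIntegral_eq_integral_mul_dbar (hγ : IsRectifiableJordanCurve γ a b)
    (hor : IsPositivelyOriented γ a b) {f χ : ℂ → ℂ}
    (hf : ContinuousOn f (curveExterior γ a b ∪ curveTrace γ a b))
    (hfE : DifferentiableOn ℂ f (curveExterior γ a b)) (hχ : ContDiff ℝ 1 χ)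
    (hχc : HasCompactSupport χ) (hχ1 : ∀ ζ ∈ curveTrace γ a b, χ ζ = 1) :
    contourIntegral γ a b f =
      -(2 * Complex.I * ∫ ζ in curveExterior γ a b, f ζ * dbar χ ζ) := by
  have hΓ := hγ.isCompact_curveTrace.isClosed
  obtain ⟨g, hg⟩ := ContinuousMap.exists_restrict_eq
    (isClosed_curveExterior_union_curveTrace hΓ) ⟨_, hf.domRestrict⟩
  have hgf : ∀ ζ ∈ curveExterior γ a b ∪ curveTrace γ a b, f ζ = g ζ := fun ζ hζ =>
    (congrArg (fun h => h ⟨ζ, hζ⟩) hg).symm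
  rw [contourIntegral_congr hγ.lt.le fun ζ hζ => hgf ζ (Or.inr hζ),
    contourIntegral_eq_integral_mul_dbar_of_continuous hγ hor g.continuous
      (hfE.congr fun ζ hζ => (hgf ζ (Or.inl hζ)).symm) hχ hχc hχ1]
  congr 2
  refine setIntegral_congr_fun (isOpen_curveExterior hΓ).measurableSet fun ζ hζ => ?_
  simp only [hgf ζ (Or.inl hζ)]

/-- The residue theorem at `∞`. The cutoffs are `1` on large discs; by the Cauchy–Pompeiu formula
the leading part `A / (ζ - z)` of `f` contributes `2πi A`, and the remainder `o(1 / |ζ|)`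
contributes nothing in the limit. -/
theorem contourIntegral_eq_of_tendsto (hγ : IsRectifiableJordanCurve γ a b)
    (hor : IsPositivelyOriented γ a b) {f : ℂ → ℂ}
    (hf : ContinuousOn f (curveExterior γ a b ∪ curveTrace γ a b))
    (hfE : DifferentiableOn ℂ f (curveExterior γ a b)) {z A : ℂ}
    (hA : Tendsto (fun ζ => (ζ - z) * f ζ) (Bornology.cobounded ℂ) (𝓝 A)) :
    contourIntegral γ a b f = 2 * π * Complex.I * A := by
  have hΓc := hγ.isCompact_curveTrace
  have hEo := isOpen_curveExterior hΓc.isClosed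
  obtain ⟨K, hK0, hcut⟩ := exists_cutoff
  obtain ⟨M, hM⟩ := hΓc.isBounded.subset_closedBall (0 : ℂ)
  set X := contourIntegral γ a b f - 2 * π * Complex.I * A with hX
  suffices hmain : ∀ η : ℝ, 0 < η → ‖X‖ ≤ η * (8 * π * K) from
    sub_eq_zero.1 (eq_zero_of_forall_norm_le_mul hmain)
  intro η hη
  have hev := Metric.tendsto_nhds.1 hA η hη
  rw [← comap_norm_atTop, (atTop_basis_Ioi.comap norm).eventually_iff] at hev
  obtain ⟨R₁, -, hR₁⟩ := hev
  set R := max (max M 0) R₁ + ‖z‖ + 1 with hR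
  have hR0 : 0 < R := by
    have := le_max_right M 0
    have := le_max_left (max M 0) R₁
    have := norm_nonneg z
    linarith
  have hfar : ∀ ζ, ζ ∉ ball z R → max M 0 < ‖ζ‖ ∧ R₁ < ‖ζ‖ := by
    intro ζ hζ
    rw [mem_ball, not_lt, dist_eq_norm] at hζ
    have h1 := norm_sub_le ζ z
    have := le_max_left (max M 0) R₁
    have := le_max_right (max M 0) R₁
    constructor <;> linarith
  have hfarE : ∀ ζ, ζ ∉ ball z R → ζ ∈ curveExterior γ a b := fun ζ hζ =>
    mem_curveExterior_of_lt_norm (le_max_right M 0)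
      (hM.trans (closedBall_subset_closedBall (le_max_left _ _))) (hfar ζ hζ).1
  obtain ⟨χ, hχ, hχc, hχ1, hχ0, hχK⟩ := hcut z R hR0
  have hdχ := continuous_dbar hχ
  have hχ1Γ : ∀ ζ ∈ curveTrace γ a b, χ ζ = 1 := by
    intro ζ hζ
    by_cases h : ζ ∈ ball z R
    · exact hχ1 ζ h
    · exact absurd hζ (hfarE ζ h).1
  -- The derivative of the cutoff lives on the annulus `S`.
  set S := closedBall z (2 * R) \ ball z R with hS
  have hSc : IsCompact S := (isCompact_closedBall z (2 * R)).diff isOpen_ball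
  have hSE : S ⊆ curveExterior γ a b := fun ζ hζ => hfarE ζ hζ.2
  have hdb0 : ∀ ζ, ζ ∉ S → dbar χ ζ = 0 := by
    intro ζ hζ
    by_cases h : ζ ∈ ball z R
    · have h0 : χ =ᶠ[𝓝 ζ] fun _ => 1 := by
        filter_upwards [isOpen_ball.mem_nhds h] with w hw using hχ1 w hw
      rw [h0.dbar_eq, dbar_eq_zero_of_differentiableAt (differentiableAt_const _)]
    · exact hχ0 ζ fun h' => hζ ⟨h', h⟩
  have hne : ∀ ζ ∈ S, R ≤ ‖ζ - z‖ := fun ζ hζ => by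
    rw [← dist_eq_norm]; exact not_lt.1 hζ.2
  have hne0 : ∀ ζ ∈ S, ζ - z ≠ 0 := fun ζ hζ h => by
    have := hne ζ hζ
    rw [h, norm_zero] at this
    linarith
  have hi1 : IntegrableOn (fun ζ => f ζ * dbar χ ζ) S :=
    ((hfE.continuousOn.mono hSE).mul hdχ.continuousOn).integrableOn_compact hSc
  have hi2 : IntegrableOn (fun ζ => dbar χ ζ * (ζ - z)⁻¹) S :=
    (hdχ.continuousOn.mul ((continuousOn_id.sub continuousOn_const).inv₀
      hne0)).integrableOn_compact hSc
  have e1 : ∫ ζ in curveExterior γ a b, f ζ * dbar χ ζ = ∫ ζ in S, f ζ * dbar χ ζ :=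
    setIntegral_eq_of_subset_of_forall_sdiff_eq_zero hEo.measurableSet hSE
      fun ζ hζ => by rw [hdb0 ζ hζ.2, mul_zero]
  have e2 : ∫ ζ in S, dbar χ ζ * (ζ - z)⁻¹ = -π := by
    rw [setIntegral_eq_integral_of_forall_compl_eq_zero
      (fun ζ hζ => by rw [hdb0 ζ hζ, zero_mul]), integral_dbar_mul_inv_sub hχ hχc,
      hχ1 z (mem_ball_self hR0), mul_one]
  have hXeq : X = -(2 * Complex.I *
      ∫ ζ in S, (f ζ * dbar χ ζ - A * (dbar χ ζ * (ζ - z)⁻¹))) := by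
    rw [integral_sub hi1 (hi2.const_mul A), integral_const_mul, e2, hX,
      contourIntegral_eq_integral_mul_dbar hγ hor hf hfE hχ hχc hχ1Γ, e1]
    ring
  have hvol : volume.real S ≤ π * (2 * R) ^ 2 := by
    rw [← volume_real_closedBall z (by positivity)]
    exact measureReal_mono sdiff_subset measure_closedBall_lt_top.ne
  have hbd : ‖∫ ζ in S, (f ζ * dbar χ ζ - A * (dbar χ ζ * (ζ - z)⁻¹))‖ ≤
      η / R * (K / R) * (π * (2 * R) ^ 2) := by
    calc _ ≤ η / R * (K / R) * volume.real S := by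
          refine norm_setIntegral_le_of_norm_le_const hSc.measure_lt_top fun ζ hζ => ?_
          have h1 : f ζ * dbar χ ζ - A * (dbar χ ζ * (ζ - z)⁻¹) =
              ((ζ - z) * f ζ - A) / (ζ - z) * dbar χ ζ := by
            have := hne0 ζ hζ
            field_simp
          have h2 : ‖(ζ - z) * f ζ - A‖ ≤ η := by
            rw [← dist_eq_norm]
            exact (hR₁ (hfar ζ hζ.2).2).le
          rw [h1, norm_mul, norm_div]
          gcongr
          · exact hne ζ hζ
          · exact hχK ζ
      _ ≤ _ := by gcongr
  rw [hXeq, norm_neg, norm_mul, norm_mul, Complex.norm_I, Complex.norm_ofNat, mul_one]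
  calc 2 * ‖∫ ζ in S, (f ζ * dbar χ ζ - A * (dbar χ ζ * (ζ - z)⁻¹))‖
      ≤ 2 * (η / R * (K / R) * (π * (2 * R) ^ 2)) := by gcongr
    _ = η * (8 * π * K) := by field_simp; ring

/-- **Cauchy's integral formula** in the exterior of a rectifiable Jordan curve, for functions
continuous up to the curve that have a limit at `∞`. -/
theorem eq_neg_contourIntegral_add (hγ : IsRectifiableJordanCurve γ a b)
    (hor : IsPositivelyOriented γ a b) {g : ℂ → ℂ}
    (hg : ContinuousOn g (curveExterior γ a b ∪ curveTrace γ a b))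
    (hgE : DifferentiableOn ℂ g (curveExterior γ a b)) {c : ℂ}
    (hc : Tendsto g (Bornology.cobounded ℂ) (𝓝 c)) {z : ℂ} (hz : z ∈ curveExterior γ a b) :
    g z = -(1 / (2 * π * Complex.I) * contourIntegral γ a b fun ζ => g ζ / (ζ - z)) + c := by
  have hΓ := hγ.isCompact_curveTrace.isClosed
  have hzE : curveExterior γ a b ∈ 𝓝 z := (isOpen_curveExterior hΓ).mem_nhds hz
  have hne : ∀ ζ ∈ curveTrace γ a b, ζ - z ≠ 0 := fun ζ hζ h =>
    hz.1 (sub_eq_zero.1 h ▸ hζ)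
  have h1 := contourIntegral_eq_of_tendsto hγ hor (f := dslope g z) (z := z) (A := c - g z)
    ((continuousOn_dslope (mem_of_superset hzE subset_union_left)).2
      ⟨hg, hgE.differentiableAt hzE⟩)
    ((Complex.differentiableOn_dslope hzE).2 hgE)
    (by simpa only [← smul_eq_mul, sub_smul_dslope] using hc.sub_const (g z))
  have h2 : contourIntegral γ a b (dslope g z) =
      contourIntegral γ a b (fun ζ => g ζ / (ζ - z)) -
        contourIntegral γ a b (fun ζ => g z * (ζ - z)⁻¹) := by
    have hinv : ContinuousOn (fun ζ => (ζ - z)⁻¹) (curveTrace γ a b) :=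
      (continuousOn_id.sub continuousOn_const).inv₀ hne
    rw [← contourIntegral_sub hγ (f := fun ζ => g ζ / (ζ - z)) (g := fun ζ => g z * (ζ - z)⁻¹) ?_
      (continuousOn_const.mul hinv)]
    · refine contourIntegral_congr hγ.lt.le fun ζ hζ => ?_
      have h := sub_smul_dslope g z ζ
      have hn := hne ζ hζ
      rw [smul_eq_mul] at h
      field_simp
      rw [← h, mul_comm]
    · simp only [div_eq_mul_inv]
      exact (hg.mono subset_union_right).mul hinv
  have h3 : contourIntegral γ a b (fun ζ => g z * (ζ - z)⁻¹) = 0 := by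
    simp only [contourIntegral, mul_assoc]
    rw [intervalIntegral.integral_const_mul, integral_inv_sub_mul_deriv_eq_zero hγ hz, mul_zero]
  rw [h3, sub_zero] at h2
  rw [← h2, h1]
  have hπ : (π : ℂ) ≠ 0 := by exact_mod_cast Real.pi_ne_zero
  field_simp
  ring

end CauchyExterior

/-! ### Polyanalytic functions and their analytic components -/

theorem differentiableAt_of_dbar_eq_zero {φ : ℂ → ℂ} {z : ℂ} (h : DifferentiableAt ℝ φ z)
    (h0 : dbar φ z = 0) : DifferentiableAt ℂ φ z := by
  refine differentiableAt_complex_iff_differentiableAt_real.2 ⟨h, ?_⟩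
  have h1 : fderiv ℝ φ z 1 + Complex.I * fderiv ℝ φ z Complex.I = 0 := by
    rw [dbar] at h0
    simpa using h0
  rw [smul_eq_mul]
  linear_combination -Complex.I * h1 + fderiv ℝ φ z Complex.I * Complex.I_mul_I

theorem dbar_sub {f g : ℂ → ℂ} {z : ℂ} (hf : DifferentiableAt ℝ f z)
    (hg : DifferentiableAt ℝ g z) : dbar (fun w => f w - g w) z = dbar f z - dbar g z := by
  simp only [dbar, fderiv_fun_sub hf hg, sub_apply]
  ring

theorem dbar_finsetSum {ι : Type*} (s : Finset ι) {f : ι → ℂ → ℂ} {z : ℂ}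
    (hf : ∀ i ∈ s, DifferentiableAt ℝ (f i) z) :
    dbar (fun w => ∑ i ∈ s, f i w) z = ∑ i ∈ s, dbar (f i) z := by
  simp only [dbar, fderiv_fun_sum hf, sum_apply]
  rw [Finset.mul_sum, ← Finset.sum_add_distrib, Finset.sum_div]

theorem differentiable_conj_real : Differentiable ℝ (starRingEnd ℂ) :=
  Complex.conjCLE.differentiable

theorem dbar_conj (z : ℂ) : dbar (starRingEnd ℂ) z = 1 := by
  have h : fderiv ℝ (starRingEnd ℂ) z = (Complex.conjCLE : ℂ →L[ℝ] ℂ) :=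
    Complex.conjCLE.hasFDerivAt.fderiv
  rw [dbar, h]
  simp only [ContinuousLinearEquiv.coe_coe, Complex.conjCLE_apply, map_one, Complex.conj_I]
  linear_combination (-1 / 2 : ℂ) * Complex.I_mul_I

theorem dbar_conj_pow (n : ℕ) (z : ℂ) :
    dbar (fun w => starRingEnd ℂ w ^ n) z = n * starRingEnd ℂ z ^ (n - 1) := by
  induction n with
  | zero =>
    simp only [pow_zero, Nat.cast_zero, zero_mul]
    exact dbar_eq_zero_of_differentiableAt (differentiableAt_const _)
  | succ n ih =>
    simp only [pow_succ]
    rw [dbar_mul ((differentiable_conj_real z).fun_pow n) (differentiable_conj_real z), ih,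
      dbar_conj]
    rcases n with - | n
    · simp
    · simp only [Nat.add_sub_cancel, pow_succ]
      push_cast
      ring

theorem contDiffOn_dbar {F : ℂ → ℂ} {U : Set ℂ} (hU : IsOpen U) {n : ℕ}
    (hF : ContDiffOn ℝ (n + 1 : ℕ) F U) : ContDiffOn ℝ n (dbar F) U := by
  have h : ContDiffOn ℝ n (fderiv ℝ F) U := hF.fderiv_of_isOpen hU (by norm_cast)
  have h1 : ∀ v, ContDiffOn ℝ n (fun z => fderiv ℝ F z v) U := fun v =>
    h.clm_apply contDiffOn_const
  exact ((h1 1).add (contDiffOn_const.mul (h1 Complex.I))).div_const 2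

theorem contDiffOn_dbar_iterate {F : ℂ → ℂ} {U : Set ℂ} (hU : IsOpen U) {n : ℕ} (m : ℕ)
    (hF : ContDiffOn ℝ (n + m : ℕ) F U) : ContDiffOn ℝ n (dbar^[m] F) U := by
  induction m generalizing F with
  | zero => exact hF
  | succ m ih => exact ih (contDiffOn_dbar hU hF)

theorem eqOn_dbar_iterate {F G : ℂ → ℂ} {U : Set ℂ} (hU : IsOpen U) (h : EqOn F G U) (m : ℕ) :
    EqOn (dbar^[m] F) (dbar^[m] G) U := by
  induction m generalizing F G with
  | zero => exact h
  | succ m ih => exact ih fun z hz => (h.eventuallyEq_of_mem (hU.mem_nhds hz)).dbar_eq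

theorem dbar_iterate_sub {F G : ℂ → ℂ} {U : Set ℂ} (hU : IsOpen U) (m : ℕ)
    (hF : ContDiffOn ℝ m F U) (hG : ContDiffOn ℝ m G U) :
    EqOn (dbar^[m] fun z => F z - G z) (fun z => (dbar^[m] F) z - (dbar^[m] G) z) U := by
  induction m generalizing F G with
  | zero => exact fun z _ => rfl
  | succ m ih =>
    have h1 : EqOn (dbar fun z => F z - G z) (fun z => dbar F z - dbar G z) U := fun z hz =>
      dbar_sub ((hF.differentiableOn (by simp)).differentiableAt (hU.mem_nhds hz))
        ((hG.differentiableOn (by simp)).differentiableAt (hU.mem_nhds hz))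
    exact (eqOn_dbar_iterate hU h1 m).trans (ih (contDiffOn_dbar hU hF) (contDiffOn_dbar hU hG))

/-- Holomorphic coefficients are constants for `∂_{z̄}`, so that `∂_{z̄}^m` acts on
`∑ Fc n · z̄^n` as the ordinary `m`-th derivative acts on polynomials in `z̄`. -/
theorem dbar_iterate_sum_mul_conj_pow {U : Set ℂ} (hU : IsOpen U) (s : Finset ℕ)
    {Fc : ℕ → ℂ → ℂ} (hFc : ∀ n ∈ s, DifferentiableOn ℂ (Fc n) U) (m : ℕ) :
    EqOn (dbar^[m] fun z => ∑ n ∈ s, Fc n z * starRingEnd ℂ z ^ n)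
      (fun z => ∑ n ∈ s, n.descFactorial m * (Fc n z * starRingEnd ℂ z ^ (n - m))) U := by
  induction m with
  | zero => exact fun z _ => by simp
  | succ m ih =>
    intro z hz
    have hd : ∀ n ∈ s, DifferentiableAt ℂ (Fc n) z := fun n hn =>
      (hFc n hn).differentiableAt (hU.mem_nhds hz)
    have hpow : ∀ j : ℕ, DifferentiableAt ℝ (fun z => starRingEnd ℂ z ^ j) z := fun j =>
      (differentiable_conj_real z).fun_pow j
    have hdr : ∀ n ∈ s, DifferentiableAt ℝ (fun z => Fc n z * starRingEnd ℂ z ^ (n - m)) z :=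
      fun n hn => ((hd n hn).restrictScalars ℝ).fun_mul (hpow _)
    rw [Function.iterate_succ_apply', (ih.eventuallyEq_of_mem (hU.mem_nhds hz)).dbar_eq,
      dbar_finsetSum s fun n hn => (differentiableAt_const _).fun_mul (hdr n hn)]
    refine Finset.sum_congr rfl fun n hn => ?_
    rw [dbar_mul (differentiableAt_const _) (hdr n hn),
      dbar_mul ((hd n hn).restrictScalars ℝ) (hpow _), dbar_conj_pow,
      dbar_eq_zero_of_differentiableAt (hd n hn),
      dbar_eq_zero_of_differentiableAt (differentiableAt_const _), Nat.descFactorial_succ,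
      Nat.sub_sub]
    push_cast
    ring

/-- Every `(k + 1)`-analytic function has analytic components: `∂_{z̄}^k F / k!` is holomorphic,
and subtracting `z̄^k` times it leaves a `k`-analytic function. -/
theorem exists_isAnalyticComponents {U : Set ℂ} (hU : IsOpen U) (k : ℕ) {F : ℂ → ℂ}
    (hF : IsPolyanalyticOn (k + 1) F U) : ∃ Fc : ℕ → ℂ → ℂ, IsAnalyticComponents k F U Fc := by
  induction k generalizing F with
  | zero =>
    refine ⟨fun _ => F, fun m _ z hz => ?_, fun z _ => by simp⟩
    exact (differentiableAt_of_dbar_eq_zero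
      ((hF.1.differentiableOn (by simp)).differentiableAt (hU.mem_nhds hz))
      (hF.2 z hz)).differentiableWithinAt
  | succ k ih =>
    set f : ℂ → ℂ := fun z => (dbar^[k + 1] F) z / (k + 1).factorial with hf
    have hC1 : ContDiffOn ℝ 1 (dbar^[k + 1] F) U := by
      have := contDiffOn_dbar_iterate hU (n := 1) (k + 1) (F := F) (by
        convert hF.1 using 2; ring)
      exact_mod_cast this
    have hfd : DifferentiableOn ℂ f U := by
      refine DifferentiableOn.div_const (fun z hz => ?_) _
      refine (differentiableAt_of_dbar_eq_zero
        ((hC1.differentiableOn one_ne_zero).differentiableAt (hU.mem_nhds hz))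
        ?_).differentiableWithinAt
      rw [← Function.iterate_succ_apply' dbar]
      exact hF.2 z hz
    have hfs : ContDiffOn ℝ (k + 1 : ℕ) f U := (hfd.contDiffOn hU).restrict_scalars ℝ
    set g : ℂ → ℂ := fun z => f z * starRingEnd ℂ z ^ (k + 1) with hg
    have hgs : ContDiffOn ℝ (k + 1 : ℕ) g U :=
      hfs.mul ((Complex.conjCLE.contDiff.pow (k + 1)).contDiffOn)
    have hFs : ContDiffOn ℝ (k + 1 : ℕ) F U := hF.1.of_le (by norm_cast; omega)
    have hgd : ∀ z ∈ U, (dbar^[k + 1] g) z = (dbar^[k + 1] F) z := by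
      intro z hz
      have h := dbar_iterate_sum_mul_conj_pow hU {k + 1} (Fc := fun _ => f)
        (fun _ _ => hfd) (k + 1) hz
      simp only [Finset.sum_singleton, Nat.descFactorial_self, Nat.sub_self, pow_zero,
        mul_one] at h
      rw [hg, h, hf]
      have : ((k + 1).factorial : ℂ) ≠ 0 := by exact_mod_cast (k + 1).factorial_ne_zero
      field_simp
    obtain ⟨Fc, hFc1, hFc2⟩ := ih (F := fun z => F z - g z) ⟨hFs.sub hgs, fun z hz => by
      rw [dbar_iterate_sub hU (k + 1) hFs hgs hz]
      simp only [hgd z hz, sub_self]⟩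
    refine ⟨fun m => if m = k + 1 then f else Fc m, fun m hm => ?_, fun z hz => ?_⟩
    · by_cases h : m = k + 1
      · simpa only [h, if_true] using hfd
      · simpa only [h, if_false] using hFc1 m (by omega)
    · beta_reduce
      rw [Finset.sum_range_succ, if_pos rfl, ← sub_eq_iff_eq_add]
      refine (hFc2 z hz).trans (Finset.sum_congr rfl fun m hm => ?_)
      rw [if_neg (by rw [Finset.mem_range] at hm; omega)]

/-- The Taylor-type sum of `F` at `ζ`, evaluated at `z` in the antiholomorphic variable only,
is `∑ Fc n (ζ) z̄^n`; in particular it is holomorphic in `ζ`. -/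
theorem sum_conj_sub_pow_mul_dbar_iterate {U : Set ℂ} (hU : IsOpen U) {k : ℕ} {F : ℂ → ℂ}
    {Fc : ℕ → ℂ → ℂ} (hFc : IsAnalyticComponents k F U Fc) (z : ℂ) {ζ : ℂ} (hζ : ζ ∈ U) :
    ∑ m ∈ Finset.range (k + 1), starRingEnd ℂ (z - ζ) ^ m / m.factorial * (dbar^[m] F) ζ =
      ∑ n ∈ Finset.range (k + 1), Fc n ζ * starRingEnd ℂ z ^ n := by
  have h : ∀ m, (dbar^[m] F) ζ = ∑ n ∈ Finset.range (k + 1),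
      n.descFactorial m * (Fc n ζ * starRingEnd ℂ ζ ^ (n - m)) := fun m =>
    (eqOn_dbar_iterate hU (fun w hw => hFc.2 w hw) m hζ).trans
      (dbar_iterate_sum_mul_conj_pow hU (Finset.range (k + 1))
        (fun n hn => hFc.1 n (by rw [Finset.mem_range] at hn; omega)) m hζ)
  simp only [h, Finset.mul_sum]
  rw [Finset.sum_comm]
  refine Finset.sum_congr rfl fun n hn => ?_
  rw [Finset.mem_range] at hn
  have hz : starRingEnd ℂ z = starRingEnd ℂ (z - ζ) + starRingEnd ℂ ζ := by
    rw [← map_add, sub_add_cancel]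
  rw [hz, add_pow, Finset.mul_sum]
  have hsub : Finset.range (n + 1) ⊆ Finset.range (k + 1) :=
    Finset.range_subset_range.2 (by omega)
  rw [← Finset.sum_subset hsub fun m _ hm => ?_]
  · refine Finset.sum_congr rfl fun m _ => ?_
    have : (m.factorial : ℂ) ≠ 0 := by exact_mod_cast m.factorial_ne_zero
    rw [Nat.descFactorial_eq_factorial_mul_choose]
    push_cast
    field_simp
  · rw [Finset.mem_range] at hm
    rw [Nat.descFactorial_eq_zero_iff_lt.2 (by omega)]
    simp

/-- Riemann's removable singularity theorem at `∞`. -/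
theorem exists_tendsto_cobounded {f : ℂ → ℂ} {R : ℝ}
    (hf : ∀ z, R < ‖z‖ → DifferentiableAt ℂ f z) (hb : IsBoundedAtInfty f) :
    ∃ c, Tendsto f (Bornology.cobounded ℂ) (𝓝 c) := by
  obtain ⟨C, R', hC⟩ := hb
  set u : ℂ → ℂ := fun w => f w⁻¹ with hu
  have hinv : Tendsto (fun w : ℂ => ‖w⁻¹‖) (𝓝[≠] 0) atTop :=
    tendsto_norm_cobounded_atTop.comp tendsto_inv₀_nhdsNE_zero
  have hd : ∀ᶠ w in 𝓝[≠] (0 : ℂ), DifferentiableAt ℂ u w := by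
    filter_upwards [hinv.eventually_gt_atTop R, self_mem_nhdsWithin] with w hw hw0
    exact (hf _ hw).comp w (differentiableAt_inv hw0)
  have hbd : IsBoundedUnder (· ≤ ·) (𝓝[≠] (0 : ℂ)) fun w => ‖u w - u 0‖ := by
    refine ⟨C + ‖u 0‖, ?_⟩
    rw [eventually_map]
    filter_upwards [hinv.eventually_ge_atTop R'] with w hw
    exact (norm_sub_le _ _).trans (by gcongr; exact hC _ hw)
  have ht := Complex.tendsto_limUnder_of_differentiable_on_punctured_nhds_of_bounded_under hd hbd
  refine ⟨_, (ht.comp tendsto_inv₀_cobounded').congr fun z => ?_⟩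
  simp [hu]

/-! ### The Cauchy formula for polyanalytic functions -/

theorem mainTheorem2
    (γ : ℝ → ℂ) (a b : ℝ)
    (hγ : IsRectifiableJordanCurve γ a b)
    (hor : IsPositivelyOriented γ a b)
    (k : ℕ) (F : ℂ → ℂ)
    (hF : IsPolyanalyticOn (k + 1) F (curveExterior γ a b))
    (hFΓ : IsContDiffUpTo k F (curveExterior γ a b) (curveTrace γ a b)) :
    (∃ Fc : ℕ → ℂ → ℂ, IsAnalyticComponents k F (curveExterior γ a b) Fc) ∧
    ∀ Fc : ℕ → ℂ → ℂ, IsAnalyticComponents k F (curveExterior γ a b) Fc →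
      (∀ m ≤ k, IsBoundedAtInfty (Fc m)) →
      ∃ c : ℕ → ℂ,
        (∀ m ≤ k, Tendsto (Fc m) (Bornology.cobounded ℂ) (𝓝 (c m))) ∧
        ∀ G : ℕ → ℂ → ℂ,
          (∀ m ≤ k, IsContinuousExtension (curveExterior γ a b) (curveTrace γ a b)
            (dbar^[m] F) (G m)) →
          ∀ z ∈ curveExterior γ a b,
            F z =
              -(∑ m ∈ Finset.range (k + 1),
                  1 / (2 * Real.pi * Complex.I) *
                    contourIntegral γ a b (fun ζ =>
                      (starRingEnd ℂ (z - ζ)) ^ m / (m.factorial * (ζ - z)) * G m ζ))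
                + ∑ m ∈ Finset.range (k + 1), c m * (starRingEnd ℂ z) ^ m := by
  have hΓ := hγ.isCompact_curveTrace
  have hEo := isOpen_curveExterior hΓ.isClosed
  refine ⟨exists_isAnalyticComponents hEo k hF, fun Fc hFc hbd => ?_⟩
  obtain ⟨M, hM⟩ := hΓ.isBounded.subset_closedBall (0 : ℂ)
  have hfar : ∀ z : ℂ, max M 0 < ‖z‖ → z ∈ curveExterior γ a b := fun z hz =>
    mem_curveExterior_of_lt_norm (le_max_right M 0)
      (hM.trans (closedBall_subset_closedBall (le_max_left _ _))) hz
  have hlim : ∀ m, ∃ c, m ≤ k → Tendsto (Fc m) (Bornology.cobounded ℂ) (𝓝 c) := by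
    intro m
    by_cases hm : m ≤ k
    · obtain ⟨c, hc⟩ := exists_tendsto_cobounded (fun z hz =>
        (hFc.1 m hm).differentiableAt (hEo.mem_nhds (hfar z hz))) (hbd m hm)
      exact ⟨c, fun _ => hc⟩
    · exact ⟨0, fun h => absurd h hm⟩
  choose c hc using hlim
  refine ⟨c, hc, fun G hG z hz => ?_⟩
  have hle : ∀ {m}, m ∈ Finset.range (k + 1) → m ≤ k := fun hm => by
    rw [Finset.mem_range] at hm; omega
  -- With `z̄` frozen, `H` is holomorphic in `Ω₋`, and Cauchy's formula applies to it.
  set H : ℂ → ℂ := fun ζ => ∑ m ∈ Finset.range (k + 1),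
    starRingEnd ℂ (z - ζ) ^ m / m.factorial * G m ζ with hH
  have hHeq : EqOn H (fun ζ => ∑ n ∈ Finset.range (k + 1), Fc n ζ * starRingEnd ℂ z ^ n)
      (curveExterior γ a b) := by
    intro ζ hζ
    simp only [hH]
    rw [← sum_conj_sub_pow_mul_dbar_iterate hEo hFc z hζ]
    exact Finset.sum_congr rfl fun m hm => by rw [(hG m (hle hm)).2 hζ]
  have hterm : ∀ m ∈ Finset.range (k + 1), ContinuousOn
      (fun ζ => starRingEnd ℂ (z - ζ) ^ m / m.factorial * G m ζ)
      (curveExterior γ a b ∪ curveTrace γ a b) := fun m hm =>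
    (Continuous.continuousOn (((Complex.continuous_conj.comp
      (continuous_const.sub continuous_id)).pow m).div_const _)).mul (hG m (hle hm)).1
  have hHc : ContinuousOn H (curveExterior γ a b ∪ curveTrace γ a b) :=
    continuousOn_finsetSum _ hterm
  have hHd : DifferentiableOn ℂ H (curveExterior γ a b) := by
    refine DifferentiableOn.congr ?_ hHeq
    exact DifferentiableOn.fun_sum fun n hn => (hFc.1 n (hle hn)).mul_const _
  have hHlim : Tendsto H (Bornology.cobounded ℂ)
      (𝓝 (∑ n ∈ Finset.range (k + 1), c n * starRingEnd ℂ z ^ n)) := by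
    refine Tendsto.congr' ?_ (tendsto_finsetSum _ fun n hn => (hc n (hle hn)).mul_const _)
    filter_upwards [tendsto_norm_cobounded_atTop.eventually_gt_atTop (max M 0)] with ζ hζ
    exact (hHeq (hfar ζ hζ)).symm
  have hHz : H z = F z := (hHeq hz).trans (hFc.2 z hz).symm
  have hint : contourIntegral γ a b (fun ζ => H ζ / (ζ - z)) =
      ∑ m ∈ Finset.range (k + 1), contourIntegral γ a b (fun ζ =>
        starRingEnd ℂ (z - ζ) ^ m / (m.factorial * (ζ - z)) * G m ζ) := by
    unfold contourIntegral
    rw [← intervalIntegral.integral_finsetSum]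
    · refine intervalIntegral.integral_congr fun t _ => ?_
      simp only [hH, Finset.sum_div, Finset.sum_mul]
      refine Finset.sum_congr rfl fun m _ => ?_
      simp only [div_eq_mul_inv, mul_inv]
      ring
    · intro m hm
      refine intervalIntegrable_mul_deriv hγ (f := fun ζ =>
        starRingEnd ℂ (z - ζ) ^ m / (m.factorial * (ζ - z)) * G m ζ) ?_
      have h1 : ContinuousOn (fun ζ => (starRingEnd ℂ (z - ζ) ^ m / m.factorial * G m ζ) *
          (ζ - z)⁻¹) (curveTrace γ a b) :=
        ((hterm m hm).mono subset_union_right).mul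
          (ContinuousOn.inv₀ (f := fun ζ => ζ - z) (continuousOn_id.sub continuousOn_const)
            fun ζ hζ h => hz.1 (sub_eq_zero.1 h ▸ hζ))
      refine h1.congr fun ζ _ => ?_
      simp only [div_eq_mul_inv, mul_inv]
      ring
  rw [← hHz, eq_neg_contourIntegral_add hγ hor hHc hHd hHlim hz, hint, Finset.mul_sum]
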